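/- **Setting.** Let $n=n_1+n_2$ and let $S\subseteq\mathbb{Z}^n$ be nonempty with $\mathrm{conv}(S)\cap\mathbb{Z}^n=S$. Suppose that $$\mathrm{conv}(S)=\mathrm{conv}\{v^1,\dots,v^g\}+\mathrm{cone}\{r^1,\dots,r^h\}$$ for some integer vectors $v^1,\dots,v^g,r^1,\dots,r^h\in\mathbb{Z}^n$, that the cone $\mathrm{cone}\{r^1,\dots,r^h\}$ is pointed, of dimension $n_2$ and contained in $\{\mathbf 0\}\times\mathbb{R}^{n_2}$, and that $\mathrm{conv}(S)\subseteq\mathrm{cone}\{e^1,\dots,e^{n_1},r^1,\dots,r^h\}$, where $e^1,\dots,e^{n_1}$ are the unit vectors of $\mathbb{R}^{n_1}\times\{\mathbf 0\}$. Let $A\in\mathbb{Z}^{m\times n}$ with rows $a_1,\dots,a_m$ and $b\in\mathbb{Z}^m$ satisfy $$Ax\ge\mathbf 0\ \text{ for all } x\in\{e^1,\dots,e^{n_1},r^1,\dots,r^h\}\quad\text{and}\quad b\ge\mathbf 0,$$ and put $P^{\downarrow}=\{x\in\mathbb{R}^n: Ax\le b\}$. **$S$-CG closure.** Let $$\Pi_{P^\downarrow}=\{(\lambda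 A,\lambda b)\in\mathbb{Z}^n\times\mathbb{R}:\ \lambda\in\mathbb{R}^m_+,\ \lambda b=\max\{\lambda Ax: x\in P^\downarrow\}\}.$$ For $(\alpha,\beta)\in\Pi_{P^\downarrow}$ let $\lfloor\beta\rfloor_{S,\alpha}=\max\{\alpha z: z\in S,\ \alpha z\le\beta\}$; the $S$-CG cut obtained from $(\alpha,\beta)$ is $\alpha x\le\lfloor\beta\rfloor_{S,\alpha}$ if some $z\in S$ satisfies $\alpha z\le\beta$, and $\mathbf 0x\le-1$ (which no point satisfies) otherwise. For $\Omega\subseteq\Pi_{P^\downarrow}$ let $P^\downarrow_{S,\Omega}$ be the set of $x\in\mathbb{R}^n$ that satisfy the $S$-CG cuts obtained from all $(\alpha,\beta)\in\Omega$, and let $P^\downarrow_S=P^\downarrow_{S,\Pi_{P^\downarrow}}$. **Constants.** Let $B=\max_i b_i$ (with $B=0$ if $m=0$), $D=\sum_{i=1}^m a_i\big(\sum_{k=1}^{n_1}e^k+\sum_{j=1}^h r^j\big)$, $M_1=2(mB+2D)$, $M_i=(2mB\cdot M_1\cdots M_{i-1})^{i-1}M_1$ for $2\le i\le m-1$, $M=M_1\cdots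 M_{m-1}$ (with $M=1$ if $m\le1$), and $M^*=mBM$. Let $$\Pi=\{(\alpha,\beta)\in\Pi_{P^\downarrow}:\ \beta/(\alpha r^j)\le M^*\ \text{for all } j\in\{1,\dots,h\}\text{ with }\alpha r^j>0\}.$$ **Theorem.** $P^\downarrow_S=P^\downarrow_{S,\Pi}$, and $P^\downarrow_S$ is a rational polyhedron (that is, the solution set of finitely many linear inequalities with rational data; it may be empty). -/

import Mathlib

open scoped Pointwise Matrix

noncomputable section

/-- An integer vector regarded as a point of `ℝⁿ`. -/
def intVec {n : ℕ} (z : Fin n → ℤ) : Fin n → ℝ := fun i => (z i : ℝ)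

/-- The polyhedron `{x ∈ ℝⁿ : A x ≤ b}` with integral data. -/
def polyhedron {m n : ℕ} (A : Matrix (Fin m) (Fin n) ℤ) (b : Fin m → ℤ) : Set (Fin n → ℝ) :=
  {x | ∀ i, intVec (A i) ⬝ᵥ x ≤ (b i : ℝ)}

/-- A rational polyhedron: the solution set of finitely many linear inequalities with rational
(equivalently, after scaling, integral) data. -/
def IsRationalPolyhedron {n : ℕ} (X : Set (Fin n → ℝ)) : Prop :=
  ∃ (k : ℕ) (A : Matrix (Fin k) (Fin n) ℤ) (b : Fin k → ℤ), X = polyhedron A b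

/-- `conv(S)` for a set `S` of integer points. -/
def convInt {n : ℕ} (S : Set (Fin n → ℤ)) : Set (Fin n → ℝ) :=
  convexHull ℝ (intVec '' S)

/-- `cone(S)`, the conic hull (always containing `0`) of a set `S` of integer vectors. -/
def coneInt {n : ℕ} (S : Set (Fin n → ℤ)) : PointedCone ℝ (Fin n → ℝ) :=
  PointedCone.hull ℝ (intVec '' S)

/-- `Π_P` for `P = {x : A x ≤ b}`: all pairs `(λA, λb) ∈ ℤⁿ × ℝ` with `λ ≥ 0` and
`λb = max {λA x : x ∈ P}`. -/
def supportingPairs {m n : ℕ} (A : Matrix (Fin m) (Fin n) ℤ) (b : Fin m → ℤ) :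
    Set ((Fin n → ℤ) × ℝ) :=
  {p | ∃ l : Fin m → ℝ, 0 ≤ l ∧
    (∀ j, (p.1 j : ℝ) = ∑ i, l i * (A i j : ℝ)) ∧
    p.2 = ∑ i, l i * (b i : ℝ) ∧
    IsGreatest ((fun x => intVec p.1 ⬝ᵥ x) '' polyhedron A b) p.2}

/-- `γ = ⌊β⌋_{S,α} = max {α z : z ∈ S, α z ≤ β}`. -/
def IsSFloor {n : ℕ} (S : Set (Fin n → ℤ)) (α : Fin n → ℤ) (β γ : ℝ) : Prop :=
  IsGreatest {t : ℝ | ∃ z ∈ S, t = intVec α ⬝ᵥ intVec z ∧ t ≤ β} γ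

/-- The points satisfying the `S`-CG cut `α x ≤ ⌊β⌋_{S,α}` obtained from `α x ≤ β`.
If no point of `S` satisfies `α z ≤ β`, the cut is `0 x ≤ -1`, so that no point satisfies it. -/
def sCGCut {n : ℕ} (S : Set (Fin n → ℤ)) (α : Fin n → ℤ) (β : ℝ) : Set (Fin n → ℝ) :=
  {x | ∃ γ, IsSFloor S α β γ ∧ intVec α ⬝ᵥ x ≤ γ}

/-- `P_{S,Ω}`: the points satisfying the `S`-CG cuts of all `(α, β) ∈ Ω`. -/
def sCGClosureOf {n : ℕ} (S : Set (Fin n → ℤ)) (Ω : Set ((Fin n → ℤ) × ℝ)) :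
    Set (Fin n → ℝ) :=
  ⋂ p ∈ Ω, sCGCut S p.1 p.2

/-- The `S`-CG closure `P_S = P_{S,Π_P}` of `P = {x : A x ≤ b}`. -/
def sCGClosure {m n : ℕ} (S : Set (Fin n → ℤ)) (A : Matrix (Fin m) (Fin n) ℤ)
    (b : Fin m → ℤ) : Set (Fin n → ℝ) :=
  sCGClosureOf S (supportingPairs A b)

/-- The ray-support `{j : α rʲ > 0}` of `α` with respect to `r¹, …, rʰ`. -/
def raySupp {n h : ℕ} (r : Fin h → Fin n → ℤ) (α : Fin n → ℤ) : Set (Fin h) :=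
  {j | 0 < α ⬝ᵥ r j}

/-- The pairs `(α, β) ∈ Π_P` all of whose intercepts `β / α rʲ`, `j` in the ray-support of `α`,
are at most `K`. -/
def boundedPairs {m n h : ℕ} (A : Matrix (Fin m) (Fin n) ℤ) (b : Fin m → ℤ)
    (r : Fin h → Fin n → ℤ) (K : ℝ) : Set ((Fin n → ℤ) × ℝ) :=
  {p ∈ supportingPairs A b | ∀ j ∈ raySupp r p.1, p.2 / ((p.1 ⬝ᵥ r j : ℤ) : ℝ) ≤ K}

/-- The unit vectors `e¹, …, e^{n₁}` of `ℝ^{n₁} × {0} ⊆ ℝ^{n₁+n₂}`. -/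
def unitVec (n₁ n₂ : ℕ) (k : Fin n₁) : Fin (n₁ + n₂) → ℤ :=
  Pi.single (Fin.castAdd n₂ k) 1

/-- `B = max_i b_i`. -/
def maxRhs {m : ℕ} (b : Fin m → ℤ) : ℤ := ⨆ i, b i

/-- `D = ∑_i a_i (∑_k e^k + ∑_j r^j)`, where `a_i` are the rows of `A`. -/
def rowRaySum {m n₁ n₂ h : ℕ} (A : Matrix (Fin m) (Fin (n₁ + n₂)) ℤ)
    (r : Fin h → Fin (n₁ + n₂) → ℤ) : ℤ :=
  ∑ i, A i ⬝ᵥ ((∑ k, unitVec n₁ n₂ k) + ∑ j, r j)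

/-- The constants `M₁ = 2 (m B + 2 D)` and `M_i = (2 m B · M₁ ⋯ M_{i-1})^{i-1} · M₁` for `i ≥ 2`.
The index is shifted by one: `tiltBound m B D i` is `M_{i+1}`. -/
def tiltBound (m : ℕ) (B D : ℤ) : ℕ → ℤ
  | 0 => 2 * (m * B + 2 * D)
  | i + 1 =>
    (2 * m * B * ∏ k : Fin (i + 1), tiltBound m B D k) ^ (i + 1) * (2 * (m * B + 2 * D))

/-- `M* = m B M` with `M = M₁ ⋯ M_{m-1}` (the empty product `1` if `m = 1`). -/
def interceptBound {m n₁ n₂ h : ℕ} (A : Matrix (Fin m) (Fin (n₁ + n₂)) ℤ) (b : Fin m → ℤ)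
    (r : Fin h → Fin (n₁ + n₂) → ℤ) : ℤ :=
  m * maxRhs b * ∏ i ∈ Finset.range (m - 1), tiltBound m (maxRhs b) (rowRaySum A r) i

end

/-! Equality of the closures is proved by tilting. Let `(α, β)` be supporting with multipliers `l`,
and suppose some ray `rʲ` with `ω = α rʲ > 0` has `β > M* ω`. Since `β ≤ m B max l`, the largest
multiplier exceeds `M ω`, while each row with positive product with `rʲ` has multiplier at most `ω`.
A ratio this large forces a gap between a set `I` of large multipliers and the rest (`exists_gap`).
Dirichlet approximation on `I` then yields natural weights `c`, nearly proportional to `l` there,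
with `l - ω c ≥ 0` (`exists_tilt`). Put `α' = α - ω cA` and `β' = β - ω cb`. This pair is again
supporting, with smaller total multiplier, so by induction some `z ∈ S` has `α'z ≤ β'` and `α'x ≤
α'z`. The gap makes `N = c(b - Az)` a nonnegative integer (`sum_mul_nonneg_of_approx`). Moving to `z
+ N rʲ ∈ S` raises `αz` by exactly `Nω`, giving the value `α'z + ω cb`: this is at most `β`, and at
least `αx` because `x` satisfies the rows used by `c`.

Polyhedrality holds for any integral intercept bound. Bounded intercepts let a finite `F ⊆ S`
realise all values `αz ≤ β` (`exists_finite_representatives`), and scaling a pair by a positive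
integer allows natural multipliers. The multipliers whose floor is attained at a given `z ∈ F` are
cut out by linear comparisons, so the cuts form a semilinear set of inequalities. Such a set is
equivalent to the finitely many inequalities given by its base points and generators
(`isRationalPolyhedron_of_isSemilinearSet`). -/

/-! ### Supporting pairs, cuts and cones -/

theorem intVec_dotProduct_intVec {n : ℕ} (a z : Fin n → ℤ) :
    intVec a ⬝ᵥ intVec z = ((a ⬝ᵥ z : ℤ) : ℝ) := by
  simp [intVec, dotProduct]

theorem intVec_dotProduct_of_eq_sum {m n : ℕ} {A : Matrix (Fin m) (Fin n) ℤ} {l : Fin m → ℝ}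
    {α : Fin n → ℤ} (hα : ∀ j, (α j : ℝ) = ∑ i, l i * (A i j : ℝ)) (x : Fin n → ℝ) :
    intVec α ⬝ᵥ x = ∑ i, l i * (intVec (A i) ⬝ᵥ x) := by
  simp only [intVec, dotProduct, hα, Finset.sum_mul, Finset.mul_sum]
  rw [Finset.sum_comm]
  exact Finset.sum_congr rfl fun i _ => Finset.sum_congr rfl fun j _ => by ring

/-- Multipliers `l ≥ 0` for which `lb = max {lAx : Ax ≤ b}` is attained: the rows in the support
of `l` are simultaneously tight at some point of the polyhedron. -/
def IsTight {m n : ℕ} (A : Matrix (Fin m) (Fin n) ℤ) (b : Fin m → ℤ) (l : Fin m → ℝ) : Prop :=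
  0 ≤ l ∧ ∃ x ∈ polyhedron A b, ∀ k, 0 < l k → intVec (A k) ⬝ᵥ x = b k

/-- Complementary slackness: `lAx ≤ lb` holds term by term, so equality means that every row in the
support of `l` is tight. Hence shrinking the support preserves the property, as tilting requires. -/
theorem mem_supportingPairs_iff {m n : ℕ} {A : Matrix (Fin m) (Fin n) ℤ} {b : Fin m → ℤ}
    {p : (Fin n → ℤ) × ℝ} :
    p ∈ supportingPairs A b ↔ ∃ l, IsTight A b l ∧ (∀ j, (p.1 j : ℝ) = ∑ i, l i * (A i j : ℝ)) ∧
      p.2 = ∑ i, l i * (b i : ℝ) := by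
  constructor
  · rintro ⟨l, hl, hα, hβ, ⟨x, hx, hxβ⟩, -⟩
    refine ⟨l, ⟨hl, x, hx, fun k hk => ?_⟩, hα, hβ⟩
    simp only [intVec_dotProduct_of_eq_sum hα, hβ] at hxβ
    have := (Finset.sum_eq_sum_iff_of_le (s := Finset.univ)
      fun i _ => mul_le_mul_of_nonneg_left (hx i) (hl i)).1 hxβ k (Finset.mem_univ k)
    exact mul_left_cancel₀ hk.ne' this
  · rintro ⟨l, ⟨hl, x, hx, ht⟩, hα, hβ⟩
    refine ⟨l, hl, hα, hβ, ⟨x, hx, ?_⟩, ?_⟩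
    · simp only [intVec_dotProduct_of_eq_sum hα, hβ]
      refine Finset.sum_congr rfl fun i _ => ?_
      rcases (hl i).eq_or_lt with h | h
      · simp [← h]
      · rw [ht i h]
    · rintro _ ⟨y, hy, rfl⟩
      simp only [intVec_dotProduct_of_eq_sum hα, hβ]
      exact Finset.sum_le_sum fun i _ => mul_le_mul_of_nonneg_left (hy i) (hl i)

/-- The values `αz` are integers bounded by `⌊β⌋`, so the maximum exists as soon as one value is
admissible; any witness `z` can then replace it. -/
theorem mem_sCGCut_iff {n : ℕ} {S : Set (Fin n → ℤ)} {α : Fin n → ℤ} {β : ℝ} {x : Fin n → ℝ} :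
    x ∈ sCGCut S α β ↔
      ∃ z ∈ S, intVec α ⬝ᵥ intVec z ≤ β ∧ intVec α ⬝ᵥ x ≤ intVec α ⬝ᵥ intVec z := by
  constructor
  · rintro ⟨γ, ⟨⟨z, hz, rfl, h⟩, -⟩, hx⟩
    exact ⟨z, hz, h, hx⟩
  · rintro ⟨z, hz, hβ, hx⟩
    simp only [intVec_dotProduct_intVec] at hβ hx
    obtain ⟨t, ⟨⟨y, hy, rfl, hyβ⟩, hmax⟩⟩ := Int.exists_greatest_of_bdd
      (P := fun t : ℤ => ∃ y ∈ S, t = α ⬝ᵥ y ∧ (t : ℝ) ≤ β)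
      ⟨⌊β⌋, fun t ⟨_, _, _, h⟩ => Int.le_floor.2 h⟩ ⟨_, z, hz, rfl, hβ⟩
    refine ⟨((α ⬝ᵥ y : ℤ) : ℝ), ⟨⟨y, hy, (intVec_dotProduct_intVec _ _).symm, hyβ⟩, ?_⟩, ?_⟩
    · rintro _ ⟨w, hw, rfl, hwβ⟩
      rw [intVec_dotProduct_intVec] at hwβ ⊢
      exact_mod_cast hmax _ ⟨w, hw, rfl, hwβ⟩
    · exact hx.trans (by exact_mod_cast hmax _ ⟨z, hz, rfl, hβ⟩)

theorem dotProduct_nonneg_of_mem_coneInt {n : ℕ} {T : Set (Fin n → ℤ)} {w x : Fin n → ℝ}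
    (hw : ∀ t ∈ T, 0 ≤ w ⬝ᵥ intVec t) (hx : x ∈ coneInt T) : 0 ≤ w ⬝ᵥ x := by
  induction hx using Submodule.span_induction with
  | mem y hy => obtain ⟨t, ht, rfl⟩ := hy; exact hw t ht
  | zero => simp
  | add y z _ _ hy hz => rw [dotProduct_add]; exact add_nonneg hy hz
  | smul a y _ hy =>
    have : (a • y : Fin n → ℝ) = (a : ℝ) • y := rfl
    rw [this, dotProduct_smul]
    exact mul_nonneg a.2 hy

theorem mem_coneInt_range_iff {n h : ℕ} {r : Fin h → Fin n → ℤ} {x : Fin n → ℝ} :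
    x ∈ coneInt (Set.range r) ↔ ∃ μ : Fin h → ℝ, 0 ≤ μ ∧ ∑ j, μ j • intVec (r j) = x := by
  rw [coneInt, PointedCone.hull, ← Set.range_comp, Submodule.mem_span_range_iff_exists_fun]
  constructor
  · rintro ⟨c, rfl⟩
    exact ⟨fun j => c j, fun j => (c j).2, rfl⟩
  · rintro ⟨μ, hμ, rfl⟩
    exact ⟨fun j => ⟨μ j, hμ j⟩, rfl⟩

theorem subset_convInt {n : ℕ} {S : Set (Fin n → ℤ)} {z : Fin n → ℤ} (hz : z ∈ S) :
    intVec z ∈ convInt S :=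
  subset_convexHull ℝ _ ⟨z, hz, rfl⟩

/-! ### Diophantine approximation and gaps among multipliers -/

/-- Rounding a family of nonnegative reals simultaneously (Dirichlet). -/
theorem exists_nat_simultaneous_approx {ι : Type*} [DecidableEq ι] (I : Finset ι) (x : ι → ℝ)
    (hx : ∀ k ∈ I, 0 ≤ x k) (Q : ℕ) (hQ : 0 < Q) :
    ∃ q : ℕ, 0 < q ∧ q ≤ Q ^ I.card ∧ ∃ c : ι → ℕ, ∀ k ∈ I, |q * x k - c k| ≤ 1 / Q := by
  have hQ' : (0 : ℝ) < Q := by exact_mod_cast hQ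
  -- Pigeonhole: `f t` records which of the `Q` boxes of width `1/Q` contains the fractional part of
  -- each `t * x k`. Two of the `Q ^ I.card + 1` values of `t` share their boxes, and their
  -- difference is `q`.
  let f : ℕ → I → Fin Q := fun t k => ⟨⌊Q * Int.fract (t * x k)⌋₊, by
    rw [Nat.floor_lt (by positivity)]
    nlinarith [Int.fract_lt_one (t * x k)]⟩
  have key : ∀ s t : ℕ, s < t → f s = f t → ∀ k ∈ I,
      |((t - s : ℕ) : ℝ) * x k - ((⌊t * x k⌋ - ⌊s * x k⌋).toNat : ℕ)| ≤ 1 / Q := by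
    intro s t hst hf k hk
    have h1 : ⌊Q * Int.fract (s * x k)⌋₊ = ⌊Q * Int.fract (t * x k)⌋₊ :=
      congrArg Fin.val (congrFun hf ⟨k, hk⟩)
    have h2 : ⌊s * x k⌋ ≤ ⌊t * x k⌋ := by
      apply Int.floor_le_floor
      have := hx k hk
      gcongr
    have h3 : (((⌊t * x k⌋ - ⌊s * x k⌋).toNat : ℕ) : ℝ) = ⌊t * x k⌋ - ⌊s * x k⌋ := by
      have : (((⌊t * x k⌋ - ⌊s * x k⌋).toNat : ℕ) : ℤ) = ⌊t * x k⌋ - ⌊s * x k⌋ :=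
        Int.toNat_of_nonneg (by omega)
      exact_mod_cast this
    rw [h3, Nat.cast_sub hst.le]
    have e : ((t : ℝ) - s) * x k - (⌊t * x k⌋ - ⌊s * x k⌋)
        = Int.fract (t * x k) - Int.fract (s * x k) := by
      simp only [Int.fract]; ring
    have a1 := Nat.floor_le (a := Q * Int.fract (s * x k)) (by positivity)
    have a2 := Nat.lt_floor_add_one (Q * Int.fract (s * x k))
    have a3 := Nat.floor_le (a := Q * Int.fract (t * x k)) (by positivity)
    have a4 := Nat.lt_floor_add_one (Q * Int.fract (t * x k))
    rw [h1] at a1 a2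
    rw [e, abs_le, ← neg_div, div_le_iff₀ hQ', le_div_iff₀ hQ']
    constructor <;> nlinarith
  obtain ⟨s, hs, t, ht, hne, hf⟩ := Finset.exists_ne_map_eq_of_card_lt_of_maps_to
    (s := Finset.range (Q ^ I.card + 1)) (t := (Finset.univ : Finset (I → Fin Q)))
    (by simp) (f := f) (fun _ _ => Finset.mem_univ _)
  rw [Finset.mem_range] at hs ht
  rcases lt_or_gt_of_ne hne with h | h
  · exact ⟨t - s, by omega, by omega, _, key s t h hf⟩
  · exact ⟨s - t, by omega, by omega, _, key t s h hf.symm⟩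

/-- If the multipliers `l` have large spread, some set `I` of large multipliers is separated from
the others by a gap. -/
theorem exists_gap {m : ℕ} (l : Fin m → ℝ) (T : ℕ → ℝ) (k₁ k₂ : Fin m)
    (hlt : (∏ i ∈ Finset.range (m - 1), T i) * l k₂ < l k₁)
    (hl : 0 ≤ l) (hT : ∀ i, 1 ≤ T i) :
    ∃ (i : ℕ) (I : Finset (Fin m)), i + 1 < m ∧ k₁ ∈ I ∧ I.card = i + 1 ∧
      (∀ k ∈ I, l k₁ ≤ (∏ t ∈ Finset.range i, T t) * l k) ∧
      ∀ k ∈ I, ∀ k' ∉ I, T i * l k' < l k := by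
  by_contra! hcon
  -- Without a gap, `I` grows from `{k₁}` one index at a time, each step losing at most the factor
  -- `T i`. After `m - 1` steps `I` contains `k₂`, contradicting the spread.
  have step : ∀ i < m, ∃ I : Finset (Fin m), k₁ ∈ I ∧ I.card = i + 1 ∧
      ∀ k ∈ I, l k₁ ≤ (∏ t ∈ Finset.range i, T t) * l k := by
    intro i
    induction i with
    | zero => exact fun _ => ⟨{k₁}, by simp⟩
    | succ i ih =>
      intro hi
      obtain ⟨I, hk, hc, hI⟩ := ih (by omega)
      obtain ⟨k, hkI, k', hk', hle⟩ := hcon i I hi hk hc hI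
      have h0 : 0 ≤ ∏ t ∈ Finset.range i, T t := Finset.prod_nonneg fun t _ => zero_le_one.trans (hT t)
      have hk1 : l k₁ ≤ (∏ t ∈ Finset.range (i + 1), T t) * l k' := by
        rw [Finset.prod_range_succ, mul_assoc]
        exact (hI k hkI).trans (mul_le_mul_of_nonneg_left hle h0)
      have hle1 : ∀ j ∈ I, l k₁ ≤ (∏ t ∈ Finset.range (i + 1), T t) * l j := fun j hj => by
        rw [Finset.prod_range_succ]
        exact (hI j hj).trans (mul_le_mul_of_nonneg_right
          (le_mul_of_one_le_right h0 (hT i)) (hl j))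
      refine ⟨insert k' I, Finset.mem_insert_of_mem hk, by simp [hk', hc], fun j hj => ?_⟩
      rcases Finset.mem_insert.1 hj with rfl | hj
      · exact hk1
      · exact hle1 j hj
  have hm : 0 < m := k₁.pos
  obtain ⟨I, -, hc, hI⟩ := step (m - 1) (by omega)
  have hu : I = Finset.univ := by
    rw [← Finset.card_eq_iff_eq_univ, hc, Fintype.card_fin]; omega
  exact absurd (hI k₂ (hu ▸ Finset.mem_univ _)) hlt.not_ge

/-- The integrality estimate behind tilting: if `c` approximates `l` on `I` up to scaling and the
multipliers outside `I` are small, then validity of `l - ω c` forces `∑ c u ≥ 0`. -/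
theorem sum_mul_nonneg_of_approx {m : ℕ} {l : Fin m → ℝ} {I : Finset (Fin m)} {k₁ : Fin m}
    {c : Fin m → ℕ} {b s : Fin m → ℤ} {X D L Q ω μ : ℝ}
    (hl : 0 ≤ l) (hl1 : 0 < l k₁) (hmax : ∀ k, l k ≤ l k₁) (hk₁ : k₁ ∈ I) (hc : ∀ k ∉ I, c k = 0)
    (hb : 0 ≤ b) (hbX : ∑ k, (b k : ℝ) ≤ X) (hs : 0 ≤ s)
    (hX : 1 ≤ X) (hD : 1 ≤ D) (hQ : Q = 2 * X * L)
    (happ : ∀ k ∈ I, |c k₁ * l k - l k₁ * c k| ≤ l k₁ / Q)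
    (hI : I = {k₁} ∨ (2 * X + 4 * D ≤ L ∧ (2 * X + 4 * D) * Q * μ ≤ l k₁))
    (hL : ∀ k ∈ I, l k₁ ≤ L * l k)
    (hμ : ∀ k ∉ I, l k ≤ μ) (hμl : c k₁ * ((2 * X + 4 * D) * μ) ≤ l k₁)
    (hω : 0 < ω) (hωμ : ω ≤ D * μ)
    (hval : 0 ≤ ∑ k, (l k - ω * c k) * (b k - s k : ℝ)) :
    0 ≤ ∑ k, (c k : ℤ) * (b k - s k) := by
  have hb' : ∀ k, (0 : ℝ) ≤ b k := fun k => by exact_mod_cast hb k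
  have hs' : ∀ k, (0 : ℝ) ≤ s k := fun k => by exact_mod_cast hs k
  have hμ0 : 0 < μ := by by_contra! h; nlinarith
  by_contra! hneg
  -- Integrality gives `N ≥ 1` if the claim fails; the rest bounds `N` below 1.
  obtain ⟨N, hN⟩ : ∃ N : ℝ, N = -∑ k, (c k : ℝ) * (b k - s k) := ⟨_, rfl⟩
  have hN1 : 1 ≤ N := by
    have : (∑ k, (c k : ℤ) * (b k - s k)) ≤ -1 := by omega
    have : (∑ k, (c k : ℝ) * (b k - s k)) ≤ -1 := by exact_mod_cast this
    linarith
  have h1 : -(ω * N) ≤ ∑ k, l k * (b k - s k : ℝ) := by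
    have : ∑ k, (l k - ω * c k) * (b k - s k : ℝ)
        = ∑ k, l k * (b k - s k : ℝ) - ω * ∑ k, (c k : ℝ) * (b k - s k) := by
      rw [Finset.mul_sum, ← Finset.sum_sub_distrib]
      exact Finset.sum_congr rfl fun k _ => by ring
    rw [hN]; linarith
  have hR : ∑ k ∈ Iᶜ, l k * (b k - s k : ℝ) ≤ X * μ := by
    calc ∑ k ∈ Iᶜ, l k * (b k - s k : ℝ) ≤ ∑ k ∈ Iᶜ, μ * b k := by
          refine Finset.sum_le_sum fun k hk => ?_
          have := hμ k (Finset.mem_compl.1 hk)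
          calc l k * (b k - s k : ℝ) ≤ l k * b k :=
                mul_le_mul_of_nonneg_left (by linarith [hs' k]) (hl k)
            _ ≤ μ * b k := mul_le_mul_of_nonneg_right this (hb' k)
      _ ≤ ∑ k, μ * b k := Finset.sum_le_sum_of_subset_of_nonneg (Finset.subset_univ _)
          fun k _ _ => mul_nonneg hμ0.le (hb' k)
      _ ≤ X * μ := by rw [← Finset.mul_sum, mul_comm]; gcongr
  -- `E` is the approximation error on `I`; it vanishes if `I = {k₁}`, and otherwise `happ` controls
  -- it once the slack data `s` on `I` are bounded through `hval`.
  obtain ⟨E, hE⟩ : ∃ E : ℝ, E = ∑ k ∈ I, (c k₁ * l k - l k₁ * c k) * (b k - s k : ℝ) := ⟨_, rfl⟩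
  have hsplit : c k₁ * ∑ k, l k * (b k - s k : ℝ)
      = -(l k₁ * N) + E + c k₁ * ∑ k ∈ Iᶜ, l k * (b k - s k : ℝ) := by
    have hNI : N = -∑ k ∈ I, (c k : ℝ) * (b k - s k) := by
      rw [hN, Finset.sum_subset (Finset.subset_univ I)]
      intro k _ hk; simp [hc k hk]
    rw [← Finset.sum_add_sum_compl I, mul_add, hNI, hE, mul_neg, neg_neg]
    congr 1
    rw [Finset.mul_sum, Finset.mul_sum, ← Finset.sum_add_distrib]
    exact Finset.sum_congr rfl fun k _ => by ring
  have hEb : E * (2 * X + 4 * D) ≤ l k₁ * (X + 2 * D + 1 / 2) + l k₁ * N * D / 12 := by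
    rcases hI with rfl | ⟨hM, hμ2⟩
    · have : E = 0 := by rw [hE, Finset.sum_singleton, mul_comm (l k₁), sub_self, zero_mul]
      rw [this, zero_mul]; positivity
    · have hL0 : 0 < L := by linarith
      have hQ0 : 0 < Q := by rw [hQ]; positivity
      have hsI : l k₁ * ∑ k ∈ I, (s k : ℝ) ≤ L * (l k₁ * X + ω * N) := by
        calc l k₁ * ∑ k ∈ I, (s k : ℝ) ≤ L * ∑ k ∈ I, l k * s k := by
              rw [Finset.mul_sum, Finset.mul_sum]
              refine Finset.sum_le_sum fun k hk => ?_
              rw [← mul_assoc]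
              exact mul_le_mul_of_nonneg_right (hL k hk) (hs' k)
          _ ≤ L * ∑ k, l k * s k := by
              gcongr
              · intro k _ _; exact mul_nonneg (hl k) (hs' k)
              · exact Finset.subset_univ _
          _ ≤ L * (l k₁ * X + ω * N) := by
              gcongr
              have e : ∑ k, l k * (b k - s k : ℝ) = ∑ k, l k * b k - ∑ k, l k * (s k : ℝ) := by
                rw [← Finset.sum_sub_distrib]
                exact Finset.sum_congr rfl fun k _ => by ring
              have : ∑ k, l k * (b k : ℝ) ≤ l k₁ * X := by
                calc ∑ k, l k * (b k : ℝ) ≤ ∑ k, l k₁ * (b k : ℝ) :=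
                      Finset.sum_le_sum fun k _ => mul_le_mul_of_nonneg_right (hmax k) (hb' k)
                  _ ≤ l k₁ * X := by rw [← Finset.mul_sum]; gcongr
              linarith
      have hE1 : E ≤ l k₁ / Q * (X + ∑ k ∈ I, (s k : ℝ)) := by
        have hbI : ∑ k ∈ I, (b k : ℝ) ≤ X :=
          (Finset.sum_le_sum_of_subset_of_nonneg (Finset.subset_univ _)
            fun k _ _ => hb' k).trans hbX
        calc E ≤ ∑ k ∈ I, l k₁ / Q * (b k + s k) := by
              rw [hE]
              refine Finset.sum_le_sum fun k hk => ?_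
              have h2 : |(b k - s k : ℝ)| ≤ b k + s k := by
                rw [abs_le]; constructor <;> linarith [hb' k, hs' k]
              have h3 := mul_le_mul (happ k hk) h2 (abs_nonneg _) (by positivity)
              rw [← abs_mul] at h3
              exact (le_abs_self _).trans h3
          _ ≤ l k₁ / Q * (X + ∑ k ∈ I, (s k : ℝ)) := by
              rw [← Finset.mul_sum, Finset.sum_add_distrib]; gcongr
      have hE2 : E * Q ≤ l k₁ * X + L * (l k₁ * X + ω * N) := by
        rw [div_mul_eq_mul_div, le_div_iff₀ hQ0] at hE1
        linarith
      have hE3 : E * (2 * X) ≤ l k₁ * X / L + (l k₁ * X + ω * N) := by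
        have : E * (2 * X) * L ≤ (l k₁ * X / L + (l k₁ * X + ω * N)) * L := by
          rw [add_mul, div_mul_cancel₀ _ hL0.ne']
          calc E * (2 * X) * L = E * Q := by rw [hQ]; ring
            _ ≤ _ := by linarith
        exact le_of_mul_le_mul_right this hL0
      have hM0 : 0 < 2 * X + 4 * D := by linarith
      have hE4 : l k₁ * X / L * (2 * X + 4 * D) ≤ l k₁ * X := by
        rw [div_mul_eq_mul_div, div_le_iff₀ hL0]; gcongr
      have hω12 : ω * (2 * X + 4 * D) ≤ l k₁ * D / 12 := by
        have h12 : 12 ≤ Q := by rw [hQ]; nlinarith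
        have h13 : ω * (2 * X + 4 * D) * 12 ≤ l k₁ * D := by
          calc ω * (2 * X + 4 * D) * 12 ≤ D * μ * (2 * X + 4 * D) * Q := by gcongr
            _ = (2 * X + 4 * D) * Q * μ * D := by ring
            _ ≤ l k₁ * D := by gcongr
        linarith
      have hE5 : E * (2 * X + 4 * D) * (2 * X)
          ≤ (l k₁ * (X + 2 * D + 1 / 2) + l k₁ * N * D / 12) * (2 * X) := by
        have h8 := mul_le_mul_of_nonneg_right hE3 hM0.le
        have h9 := mul_le_mul_of_nonneg_right hω12 (zero_le_one.trans hN1)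
        have h10 : l k₁ * N * D / 12 ≤ l k₁ * N * D / 12 * (2 * X) :=
          le_mul_of_one_le_right (by positivity) (by linarith)
        linarith
      exact le_of_mul_le_mul_right hE5 (by linarith)
  have hfin : (l k₁ - c k₁ * ω) * N ≤ E + c k₁ * (X * μ) := by
    have hc0 : (0 : ℝ) ≤ c k₁ := Nat.cast_nonneg _
    have := mul_le_mul_of_nonneg_left h1 hc0
    have := mul_le_mul_of_nonneg_left hR hc0
    linarith
  have hM0 : 0 < 2 * X + 4 * D := by linarith
  have hq : c k₁ * ω * (2 * X + 4 * D) ≤ D * l k₁ := by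
    calc c k₁ * ω * (2 * X + 4 * D) ≤ c k₁ * (D * μ) * (2 * X + 4 * D) := by gcongr
      _ = D * (c k₁ * ((2 * X + 4 * D) * μ)) := by ring
      _ ≤ D * l k₁ := by gcongr
  have h2 := mul_le_mul_of_nonneg_right hfin hM0.le
  have h3 := mul_le_mul_of_nonneg_right hq (zero_le_one.trans hN1)
  have h4 := mul_le_mul_of_nonneg_left hμl (zero_le_one.trans hX)
  -- This is `hfin` multiplied by `2X + 4D`, with the three error bounds inserted. For `N ≥ 1` it
  -- would give `(11/12) D ≤ 1/2`, contradicting `D ≥ 1`.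
  have h5 : l k₁ * ((2 * X + 3 * D - D / 12) * N) ≤ l k₁ * (2 * X + 2 * D + 1 / 2) := by
    linarith
  have h6 := le_of_mul_le_mul_left h5 hl1
  have h7 : 2 * X + 3 * D - D / 12 ≤ (2 * X + 3 * D - D / 12) * N :=
    le_mul_of_one_le_right (by linarith) hN1
  linarith

/-- One formula covers both cases, since at `i = 0` the power is 1. The base is the Dirichlet
parameter `Q` and the exponent the number of approximated ratios. -/
theorem tiltBound_eq (m : ℕ) (B D : ℤ) (i : ℕ) :
    tiltBound m B D i =
      (2 * (m * B) * ∏ t ∈ Finset.range i, tiltBound m B D t) ^ i * (2 * (m * B) + 4 * D) := by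
  cases i with
  | zero => rw [tiltBound]; ring
  | succ i => rw [tiltBound, Finset.prod_range]; ring

theorem one_le_tiltBound {m : ℕ} {B D : ℤ} (hX : 1 ≤ m * B) (hD : 0 ≤ D) (i : ℕ) :
    1 ≤ tiltBound m B D i := by
  induction i using Nat.strong_induction_on with
  | _ i ih =>
    have h1 : 1 ≤ ∏ t ∈ Finset.range i, tiltBound m B D t :=
      Int.add_one_le_of_lt (Finset.prod_pos fun t ht =>
        zero_lt_one.trans_le (ih t (Finset.mem_range.1 ht)))
    rw [tiltBound_eq]
    have h2 : 1 ≤ 2 * (m * B) * ∏ t ∈ Finset.range i, tiltBound m B D t := by nlinarith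
    have h3 := one_le_pow₀ h2 (n := i)
    nlinarith

/-- Integral tilting weights: subtracting `ω c` from the multipliers `l` keeps them nonnegative,
and any pair of slack data valid for the tilted multipliers is valid for `c` itself. -/
theorem exists_tilt {m : ℕ} {B D : ℤ} {l : Fin m → ℝ} {b w : Fin m → ℤ} {k₁ : Fin m}
    (hl : 0 ≤ l) (hmax : ∀ k, l k ≤ l k₁) (hb : 0 ≤ b) (hbB : ∀ k, b k ≤ B) (hB : 1 ≤ B)
    (hw : 0 ≤ w) (hwD : ∑ k, w k ≤ D)
    (hlt : ∀ k, 0 < w k →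
      ((∏ i ∈ Finset.range (m - 1), tiltBound m B D i : ℤ) : ℝ) * l k < l k₁)
    (hω : 0 < ∑ k, l k * (w k : ℝ)) :
    ∃ c : Fin m → ℕ, 0 < c k₁ ∧ (∀ k, (∑ k, l k * (w k : ℝ)) * c k ≤ l k) ∧
      ∀ s : Fin m → ℤ, 0 ≤ s →
        0 ≤ ∑ k, (l k - (∑ k, l k * (w k : ℝ)) * c k) * (b k - s k : ℝ) →
        0 ≤ ∑ k, (c k : ℤ) * (b k - s k) := by
  classical
  obtain ⟨ω, hωdef⟩ : ∃ ω, ω = ∑ k, l k * (w k : ℝ) := ⟨_, rfl⟩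
  rw [← hωdef] at hω ⊢
  obtain ⟨k₂, hk₂⟩ : ∃ k, 0 < w k := by
    by_contra! h
    have : ω ≤ 0 := hωdef ▸ Finset.sum_nonpos fun k _ =>
      mul_nonpos_of_nonneg_of_nonpos (hl k) (by exact_mod_cast h k)
    linarith
  have hD : 1 ≤ D := by
    have : w k₂ ≤ ∑ k, w k := Finset.single_le_sum (fun k _ => hw k) (Finset.mem_univ k₂)
    omega
  have hm : 0 < m := k₁.pos
  have hX : 1 ≤ m * B := by
    have : (1 : ℤ) ≤ m := by exact_mod_cast hm
    nlinarith
  have hT := one_le_tiltBound hX (zero_le_one.trans hD)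
  have hTR : ∀ i, (1 : ℝ) ≤ (tiltBound m B D i : ℝ) := fun i => by exact_mod_cast hT i
  have hprod : ∀ i, (1 : ℝ) ≤ ∏ t ∈ Finset.range i, (tiltBound m B D t : ℝ) := fun i => by
    induction i with
    | zero => simp
    | succ i ih => rw [Finset.prod_range_succ]; exact one_le_mul_of_one_le_of_one_le ih (hTR i)
  have hmono : ∀ i j, i ≤ j → ∏ t ∈ Finset.range i, (tiltBound m B D t : ℝ)
      ≤ ∏ t ∈ Finset.range j, (tiltBound m B D t : ℝ) := fun i j hij => by
    induction j, hij using Nat.le_induction with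
    | base => exact le_rfl
    | succ j hj ih =>
      rw [Finset.prod_range_succ]
      exact ih.trans (le_mul_of_one_le_right (zero_le_one.trans (hprod j)) (hTR j))
  simp only [Int.cast_prod] at hlt
  obtain ⟨i, I, him, hk₁, hcard, hI, hgap⟩ := exists_gap l (fun t => (tiltBound m B D t : ℝ))
    k₁ k₂ (hlt k₂ hk₂) hl hTR
  -- Multipliers in `I` are at least `l k₁` over a partial product of the bounds; rows with positive
  -- weight lie below `l k₁` over the full product.
  have hwI : ∀ k ∈ I, w k = 0 := by
    intro k hk
    by_contra hne
    have h1 := hlt k (lt_of_le_of_ne (hw k) (Ne.symm hne))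
    have h2 := mul_le_mul_of_nonneg_right (hmono i (m - 1) (by omega)) (hl k)
    exact absurd (hI k hk) (not_le.2 (h2.trans_lt h1))
  have hk₂I : k₂ ∈ Iᶜ := Finset.mem_compl.2 fun h => hk₂.ne' (hwI k₂ h)
  -- `l k₃` plays the role of `μ`. As `w` lives outside `I`, it controls `ω`.
  obtain ⟨k₃, hk₃, hmax₃⟩ := Finset.exists_max_image Iᶜ l ⟨k₂, hk₂I⟩
  have hωμ : ω ≤ D * l k₃ := by
    calc ω ≤ ∑ k, (w k : ℝ) * l k₃ := by
          rw [hωdef]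
          refine Finset.sum_le_sum fun k _ => ?_
          by_cases hk : k ∈ I
          · simp [hwI k hk]
          · rw [mul_comm]
            exact mul_le_mul_of_nonneg_left (hmax₃ k (Finset.mem_compl.2 hk))
              (by exact_mod_cast hw k)
      _ ≤ D * l k₃ := by
          rw [← Finset.sum_mul]
          exact mul_le_mul_of_nonneg_right (by exact_mod_cast hwD) (hl k₃)
  obtain ⟨L, hLdef⟩ : ∃ L : ℤ, L = ∏ t ∈ Finset.range i, tiltBound m B D t := ⟨_, rfl⟩
  have hLR : (L : ℝ) = ∏ t ∈ Finset.range i, (tiltBound m B D t : ℝ) := by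
    rw [hLdef, Int.cast_prod]
  have hL1 : (1 : ℝ) ≤ L := hLR ▸ hprod i
  have hXR : (1 : ℝ) ≤ m * B := by exact_mod_cast hX
  have hDR : (1 : ℝ) ≤ D := by exact_mod_cast hD
  have hTi : (tiltBound m B D i : ℝ) = (2 * (m * B) * L) ^ i * (2 * (m * B) + 4 * D) := by
    rw [tiltBound_eq, hLdef]; push_cast; rfl
  obtain ⟨Q, hQ⟩ : ∃ Q : ℕ, (Q : ℤ) = 2 * (m * B) * L :=
    Int.eq_ofNat_of_zero_le (a := 2 * (m * B) * L) (by
      have : (1 : ℤ) ≤ L := by exact_mod_cast hL1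
      positivity) |>.imp fun _ h => h.symm
  have hQR : (Q : ℝ) = 2 * (m * B) * L := by exact_mod_cast hQ
  have hl1 : 0 < l k₁ := (mul_nonneg (zero_le_one.trans (hprod _)) (hl k₂)).trans_lt (hlt k₂ hk₂)
  have hQ2 : (2 : ℝ) ≤ Q := by rw [hQR]; nlinarith
  have hQ0 : 0 < Q := by exact_mod_cast (show (0 : ℝ) < Q by linarith)
  -- The ratio at `k₁` is 1 and needs no approximation. Erasing it leaves `i` ratios, so `q ≤ Q ^
  -- i`, which is what the gap `tiltBound m B D i` absorbs.
  obtain ⟨q, hq0, hqQ, c', hc'⟩ := exists_nat_simultaneous_approx (I.erase k₁)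
    (fun k => l k / l k₁) (fun k _ => div_nonneg (hl k) hl1.le) Q hQ0
  rw [Finset.card_erase_of_mem hk₁, hcard, Nat.add_sub_cancel] at hqQ
  have hq1 : (1 : ℝ) ≤ q := by exact_mod_cast hq0
  have hqQR : (q : ℝ) ≤ (Q : ℝ) ^ i := by exact_mod_cast hqQ
  have hQμ : (Q : ℝ) ^ i * ((2 * (m * B) + 4 * D) * l k₃) ≤ l k₁ := by
    have := (hgap k₁ hk₁ k₃ (Finset.mem_compl.1 hk₃)).le
    rw [hTi, ← hQR, mul_assoc] at this
    exact this
  have hMμ : 0 ≤ (2 * (m * B) + 4 * D) * l k₃ := mul_nonneg (by linarith) (hl k₃)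
  have hqμ : q * ((2 * (m * B) + 4 * D) * l k₃) ≤ l k₁ :=
    (mul_le_mul_of_nonneg_right hqQR hMμ).trans hQμ
  obtain ⟨c, hcdef⟩ : ∃ c : Fin m → ℕ,
      c = fun k => if k = k₁ then q else if k ∈ I then c' k else 0 := ⟨_, rfl⟩
  have hc₁ : c k₁ = q := by simp [hcdef]
  have hcI : ∀ k ∉ I, c k = 0 := fun k hk => by
    have : k ≠ k₁ := fun h => hk (h ▸ hk₁)
    simp [hcdef, hk, this]
  have happ : ∀ k ∈ I, |c k₁ * l k - l k₁ * c k| ≤ l k₁ / Q := by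
    intro k hk
    by_cases h : k = k₁
    · rw [h, mul_comm, sub_self, abs_zero]; positivity
    · have h1 := hc' k (Finset.mem_erase.2 ⟨h, hk⟩)
      have h2 : c k = c' k := by simp [hcdef, h, hk]
      have h3 : (c k₁ * l k - l k₁ * c k : ℝ) = l k₁ * (q * (l k / l k₁) - c' k) := by
        rw [hc₁, h2]; field_simp
      rw [h3, abs_mul, abs_of_pos hl1, div_eq_mul_one_div (l k₁) (Q : ℝ)]
      exact mul_le_mul_of_nonneg_left h1 hl1.le
  refine ⟨c, hc₁ ▸ hq0, fun k => ?_, fun s hs hval => ?_⟩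
  · by_cases hk : k ∈ I
    · have h1 := (abs_le.1 (happ k hk)).1
      have h2 : l k₁ / Q ≤ l k := by
        rw [div_le_iff₀ (by linarith)]
        have := hI k hk
        rw [← hLR] at this
        have h4 : (L : ℝ) ≤ Q := by rw [hQR]; nlinarith
        nlinarith [mul_le_mul_of_nonneg_right h4 (hl k)]
      have h3 : l k₁ * c k ≤ 2 * q * l k := by
        rw [hc₁] at h1
        have := le_mul_of_one_le_left (hl k) hq1
        linarith
      have h5 : l k₁ * (ω * c k) ≤ l k₁ * l k := by
        calc l k₁ * (ω * c k) = ω * (l k₁ * c k) := by ring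
          _ ≤ D * l k₃ * (2 * q * l k) := by
              have := hω.le.trans hωμ
              gcongr
          _ = (q * (2 * D * l k₃)) * l k := by ring
          _ ≤ (q * ((2 * (m * B) + 4 * D) * l k₃)) * l k := by
              have := hl k
              have := hl k₃
              gcongr
              linarith
          _ ≤ l k₁ * l k := mul_le_mul_of_nonneg_right hqμ (hl k)
      exact le_of_mul_le_mul_left h5 hl1
    · rw [hcI k hk, Nat.cast_zero, mul_zero]; exact hl k
  · refine sum_mul_nonneg_of_approx (X := m * B) (D := D) (L := L) (Q := Q) (μ := l k₃) hl hl1 hmax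
      hk₁ hcI hb ?_ hs hXR hDR hQR happ ?_ (by rw [hLR]; exact hI)
      (fun k hk => hmax₃ k (Finset.mem_compl.2 hk)) (by rw [hc₁]; exact hqμ) hω hωμ hval
    · calc ∑ k, (b k : ℝ) ≤ ∑ k : Fin m, (B : ℝ) :=
            Finset.sum_le_sum fun k _ => by exact_mod_cast hbB k
        _ = m * B := by simp
    · rcases Nat.eq_zero_or_pos i with hi | hi
      · left
        obtain ⟨a, ha⟩ := Finset.card_eq_one.1 (hi ▸ hcard)
        rw [ha, Finset.mem_singleton] at hk₁
        rw [ha, hk₁]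
      · right
        constructor
        · have h1 := hmono 1 i hi
          rw [Finset.prod_range_one, tiltBound_eq, ← hLR] at h1
          simpa using h1
        · have h1 : (Q : ℝ) ≤ (Q : ℝ) ^ i := le_self_pow₀ (by linarith) (by omega)
          calc (2 * (m * B) + 4 * D) * Q * l k₃ = Q * ((2 * (m * B) + 4 * D) * l k₃) := by ring
            _ ≤ Q ^ i * ((2 * (m * B) + 4 * D) * l k₃) := mul_le_mul_of_nonneg_right h1 hMμ
            _ ≤ l k₁ := hQμ

/-! ### Large intercepts are redundant -/

theorem le_maxRhs {m : ℕ} (b : Fin m → ℤ) (k : Fin m) : b k ≤ maxRhs b :=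
  le_ciSup (Set.finite_range b).bddAbove k

theorem sum_dotProduct_le_rowRaySum {m n₁ n₂ h : ℕ} {A : Matrix (Fin m) (Fin (n₁ + n₂)) ℤ}
    {r : Fin h → Fin (n₁ + n₂) → ℤ} (hAe : ∀ k, 0 ≤ A *ᵥ unitVec n₁ n₂ k)
    (hAr : ∀ j, 0 ≤ A *ᵥ r j) (j : Fin h) : ∑ k, A k ⬝ᵥ r j ≤ rowRaySum A r := by
  refine Finset.sum_le_sum fun k _ => ?_
  rw [dotProduct_add, dotProduct_sum, dotProduct_sum]
  have h1 : 0 ≤ ∑ t, A k ⬝ᵥ unitVec n₁ n₂ t := Finset.sum_nonneg fun t _ => hAe t k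
  have h2 : A k ⬝ᵥ r j ≤ ∑ t, A k ⬝ᵥ r t :=
    Finset.single_le_sum (f := fun t => A k ⬝ᵥ r t) (fun t _ => hAr t k) (Finset.mem_univ j)
  omega

theorem mem_sCGClosureOf_iff {n : ℕ} {S : Set (Fin n → ℤ)} {Ω : Set ((Fin n → ℤ) × ℝ)}
    {x : Fin n → ℝ} : x ∈ sCGClosureOf S Ω ↔ ∀ p ∈ Ω, x ∈ sCGCut S p.1 p.2 := by
  simp [sCGClosureOf]

-- Induction on an integer above `∑ l`: if an intercept is too large, tilting lowers the sum by at
-- least 1, and the witness for the tilted cut is moved along the ray `r j`.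
set_option maxHeartbeats 400000 in
theorem mem_sCGCut_of_mem_closure {m n₁ n₂ h : ℕ} {S : Set (Fin (n₁ + n₂) → ℤ)}
    {A : Matrix (Fin m) (Fin (n₁ + n₂)) ℤ} {b : Fin m → ℤ} {r : Fin h → Fin (n₁ + n₂) → ℤ}
    (hSr : ∀ z ∈ S, ∀ j, ∀ N : ℕ, z + N • r j ∈ S) (hSA : ∀ z ∈ S, ∀ k, 0 ≤ A k ⬝ᵥ z)
    (hAe : ∀ k, 0 ≤ A *ᵥ unitVec n₁ n₂ k) (hAr : ∀ j, 0 ≤ A *ᵥ r j) (hb : 0 ≤ b)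
    {x : Fin (n₁ + n₂) → ℝ}
    (hx : x ∈ sCGClosureOf S (boundedPairs A b r (interceptBound A b r)))
    {p : (Fin (n₁ + n₂) → ℤ) × ℝ} (hp : p ∈ supportingPairs A b) : x ∈ sCGCut S p.1 p.2 := by
  obtain ⟨l, hl, hα, hβ⟩ := mem_supportingPairs_iff.1 hp
  obtain ⟨n, hn⟩ := exists_nat_gt (∑ k, l k)
  induction n generalizing p l with
  | zero =>
    have := Finset.sum_nonneg fun k (_ : k ∈ Finset.univ) => hl.1 k
    simp at hn
    linarith
  | succ n ih =>
    obtain ⟨α, β⟩ := p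
    simp only at hα hβ ⊢
    by_cases hbd : (α, β) ∈ boundedPairs A b r (interceptBound A b r)
    · exact mem_sCGClosureOf_iff.1 hx _ hbd
    obtain ⟨j, hj, hjK⟩ : ∃ j, 0 < α ⬝ᵥ r j ∧
        (interceptBound A b r : ℝ) < β / ((α ⬝ᵥ r j : ℤ) : ℝ) := by
      by_contra! hcon
      exact hbd ⟨hp, fun j hj => hcon j hj⟩
    have hωR : ((α ⬝ᵥ r j : ℤ) : ℝ) = ∑ k, l k * ((A k ⬝ᵥ r j : ℤ) : ℝ) := by
      rw [← intVec_dotProduct_intVec, intVec_dotProduct_of_eq_sum hα]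
      simp only [intVec_dotProduct_intVec]
    obtain ⟨ω, hω⟩ : ∃ ω, ω = α ⬝ᵥ r j := ⟨_, rfl⟩
    rw [← hω] at hj hjK hωR
    have hωpos : (0 : ℝ) < ω := by exact_mod_cast hj
    have hω1 : (1 : ℝ) ≤ ω := by exact_mod_cast hj
    obtain ⟨B, hB⟩ : ∃ B, B = maxRhs b := ⟨_, rfl⟩
    have hbB : ∀ k, b k ≤ B := hB ▸ le_maxRhs b
    have hm : Nonempty (Fin m) := by
      by_contra hne
      rw [not_nonempty_iff] at hne
      simp at hωR
      omega
    obtain ⟨k₁, -, hmax⟩ := Finset.exists_max_image Finset.univ l Finset.univ_nonempty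
    replace hmax : ∀ k, l k ≤ l k₁ := fun k => hmax k (Finset.mem_univ k)
    have hw : ∀ k, 0 ≤ A k ⬝ᵥ r j := fun k => hAr j k
    have hwD := sum_dotProduct_le_rowRaySum hAe hAr j
    have hD : 0 ≤ rowRaySum A r := (Finset.sum_nonneg fun k _ => hw k).trans hwD
    have hβle : β ≤ m * B * l k₁ := by
      calc β ≤ ∑ k : Fin m, l k₁ * (B : ℝ) := by
            rw [hβ]
            refine Finset.sum_le_sum fun k _ => ?_
            exact mul_le_mul (hmax k) (by exact_mod_cast hbB k) (by exact_mod_cast hb k) (hl.1 k₁)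
        _ = m * B * l k₁ := by simp; ring
    rw [lt_div_iff₀ hωpos] at hjK
    have hB1 : 1 ≤ B := by
      by_contra hB0
      have hB0 : B = 0 := by
        have := hb k₁
        have := hbB k₁
        simp only [Pi.zero_apply] at *
        omega
      rw [interceptBound, ← hB, hB0] at hjK
      rw [hB0] at hβle
      simp at hjK hβle
      linarith
    have hX : 1 ≤ m * B := by
      have : (1 : ℤ) ≤ m := by exact_mod_cast Fin.pos_iff_nonempty.2 hm
      nlinarith
    have hXR : (1 : ℝ) ≤ m * B := by exact_mod_cast hX
    obtain ⟨M, hM⟩ : ∃ M, M = ∏ i ∈ Finset.range (m - 1), tiltBound m B (rowRaySum A r) i :=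
      ⟨_, rfl⟩
    have hM1 : 1 ≤ M := hM ▸ Int.add_one_le_of_lt (Finset.prod_pos fun t _ =>
      zero_lt_one.trans_le (one_le_tiltBound hX hD t))
    have hK : interceptBound A b r = m * B * M := by rw [interceptBound, hM, hB]
    obtain ⟨c, hc₁, hcl, hcN⟩ := exists_tilt (D := rowRaySum A r) (w := fun k => A k ⬝ᵥ r j)
      hl.1 hmax hb hbB hB1 hw hwD (fun k hk => by
        rw [← hM]
        have h1 : l k ≤ ω := by
          rw [hωR]
          refine le_trans ?_ (Finset.single_le_sum
            (f := fun k => l k * ((A k ⬝ᵥ r j : ℤ) : ℝ))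
            (fun k _ => mul_nonneg (hl.1 k) (by exact_mod_cast hw k)) (Finset.mem_univ k))
          exact le_mul_of_one_le_right (hl.1 k) (by exact_mod_cast hk)
        have h2 : (m * B : ℝ) * (M * ω) < m * B * l k₁ := by
          rw [hK] at hjK
          push_cast at hjK
          linarith
        have h3 : (M : ℝ) * l k ≤ M * ω :=
          mul_le_mul_of_nonneg_left h1 (by exact_mod_cast zero_le_one.trans hM1)
        exact h3.trans_lt (lt_of_mul_lt_mul_left h2 (by linarith))) (hωR ▸ hωpos)
    rw [← hωR] at hcl hcN
    obtain ⟨l', hl'⟩ : ∃ l' : Fin m → ℝ, l' = fun k => l k - ω * c k := ⟨_, rfl⟩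
    obtain ⟨α', hα'⟩ : ∃ α' : Fin (n₁ + n₂) → ℤ, α' = fun t => α t - ω * ∑ k, c k * A k t :=
      ⟨_, rfl⟩
    obtain ⟨y, hy, hyt⟩ := hl.2
    have hl't : IsTight A b l' := by
      refine ⟨fun k => by simpa [hl'] using hcl k, y, hy, fun k hk => hyt k ?_⟩
      refine hk.trans_le ?_
      rw [hl']
      exact sub_le_self _ (by positivity)
    have hα's : ∀ t, (α' t : ℝ) = ∑ k, l' k * (A k t : ℝ) := by
      intro t
      simp only [hα', hl', sub_mul, Finset.sum_sub_distrib, ← hα]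
      push_cast
      simp only [Finset.mul_sum, mul_assoc]
    -- The decrease is at least `ω * c k₁ ≥ 1`, both factors being positive integers.
    have hsum : ∑ k, l' k < n := by
      have h1 : (1 : ℝ) ≤ ∑ k, ω * (c k : ℝ) := by
        refine le_trans ?_ (Finset.single_le_sum (f := fun k => ω * (c k : ℝ))
          (fun k _ => by positivity) (Finset.mem_univ k₁))
        have : (1 : ℝ) ≤ c k₁ := by exact_mod_cast hc₁
        exact one_le_mul_of_one_le_of_one_le hω1 this
      simp only [hl', Finset.sum_sub_distrib]
      push_cast at hn
      linarith
    obtain ⟨z, hz, hzβ, hxz⟩ := mem_sCGCut_iff.1 (ih (p := (α', ∑ k, l' k * (b k : ℝ)))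
      (mem_supportingPairs_iff.2 ⟨l', hl't, hα's, rfl⟩) l' hl't hα's rfl hsum)
    simp only at hzβ hxz
    have hαv : ∀ v, intVec α ⬝ᵥ v = intVec α' ⬝ᵥ v + ω * ∑ k, c k * (intVec (A k) ⬝ᵥ v) := by
      intro v
      rw [intVec_dotProduct_of_eq_sum hα, intVec_dotProduct_of_eq_sum hα's, Finset.mul_sum,
        ← Finset.sum_add_distrib]
      exact Finset.sum_congr rfl fun k _ => by rw [hl']; ring
    have hN := hcN (fun k => A k ⬝ᵥ z) (fun k => hSA z hz k) (by
      rw [intVec_dotProduct_of_eq_sum hα's] at hzβ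
      simp only [intVec_dotProduct_intVec] at hzβ
      simp only [mul_sub, Finset.sum_sub_distrib]
      simpa [hl'] using hzβ)
    obtain ⟨N, hNdef⟩ := Int.eq_ofNat_of_zero_le hN
    have hNR : (N : ℝ) = ∑ k, (c k : ℝ) * (b k - ((A k ⬝ᵥ z : ℤ) : ℝ)) := by
      exact_mod_cast hNdef.symm
    have hval : intVec α ⬝ᵥ intVec (z + N • r j)
        = intVec α' ⬝ᵥ intVec z + ω * ∑ k, (c k : ℝ) * b k := by
      have h1 : intVec α ⬝ᵥ intVec (z + N • r j) = intVec α ⬝ᵥ intVec z + N * ω := by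
        simp only [intVec_dotProduct_intVec, dotProduct_add, dotProduct_smul, ← hω]
        simp
      rw [h1, hαv, hNR]
      simp only [intVec_dotProduct_intVec, mul_sub, Finset.sum_sub_distrib]
      ring
    refine mem_sCGCut_iff.2 ⟨z + N • r j, hSr z hz j N, ?_, ?_⟩
    · have h1 : β = ∑ k, l' k * (b k : ℝ) + ω * ∑ k, (c k : ℝ) * b k := by
        rw [hβ, Finset.mul_sum, ← Finset.sum_add_distrib]
        exact Finset.sum_congr rfl fun k _ => by rw [hl']; ring
      rw [hval, h1]
      linarith
    · rw [hval, hαv]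
      -- A row tight at `y` is itself a supporting pair, with unit multiplier. Its positive ray
      -- products are integers, so its intercepts are at most `b k`, hence within the bound.
      have hrow : ∀ k, 0 < l k → intVec (A k) ⬝ᵥ x ≤ b k := by
        intro k hk
        have hmem : (A k, (b k : ℝ)) ∈ boundedPairs A b r (interceptBound A b r) := by
          refine ⟨mem_supportingPairs_iff.2 ⟨Pi.single k 1, ⟨?_, y, hy, fun i hi => ?_⟩, ?_, ?_⟩,
            fun i hi => ?_⟩
          · simp
          · by_cases hik : i = k
            · rw [hik]; exact hyt k hk
            · simp [hik] at hi
          · intro t; simp [Pi.single_apply]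
          · simp [Pi.single_apply]
          · have h1 : (1 : ℝ) ≤ ((A k ⬝ᵥ r i : ℤ) : ℝ) := by exact_mod_cast hi
            have h2 : b k ≤ interceptBound A b r := by
              rw [hK]
              have := hbB k
              have h3 : (1 : ℤ) ≤ m := by exact_mod_cast Fin.pos_iff_nonempty.2 hm
              have h4 : B ≤ m * B := le_mul_of_one_le_left (by omega) h3
              have h5 : m * B ≤ m * B * M := le_mul_of_one_le_right (by omega) hM1
              omega
            have h6 : (0 : ℝ) ≤ b k := by exact_mod_cast hb k
            have h7 : (b k : ℝ) ≤ interceptBound A b r := by exact_mod_cast h2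
            exact (div_le_self h6 h1).trans h7
        obtain ⟨z', -, h1, h2⟩ := mem_sCGCut_iff.1 (mem_sCGClosureOf_iff.1 hx _ hmem)
        exact h2.trans h1
      have : ∑ k, (c k : ℝ) * (intVec (A k) ⬝ᵥ x) ≤ ∑ k, (c k : ℝ) * b k := by
        refine Finset.sum_le_sum fun k _ => ?_
        rcases Nat.eq_zero_or_pos (c k) with h0 | h0
        · simp [h0]
        · have h1 : (0 : ℝ) < c k := by exact_mod_cast h0
          exact mul_le_mul_of_nonneg_left
            (hrow k ((mul_pos hωpos h1).trans_le (hcl k))) h1.le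
      have := mul_le_mul_of_nonneg_left this hωpos.le
      linarith

/-! ### Semilinear families of inequalities -/

/-- The additive map `μ ↦ ∑ μ_k w_k` on natural multipliers. -/
def combHom {m : ℕ} {G : Type*} [AddCommMonoid G] (w : Fin m → G) : (Fin m → ℕ) →+ G where
  toFun μ := ∑ k, μ k • w k
  map_zero' := by simp
  map_add' μ ν := by simp [add_smul, Finset.sum_add_distrib]

theorem combHom_apply {m : ℕ} {G : Type*} [AddCommMonoid G] (w : Fin m → G) (μ : Fin m → ℕ) :
    combHom w μ = ∑ k, μ k • w k := rfl

theorem isSemilinearSet_combHom_le {m : ℕ} (u w : Fin m → ℤ) :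
    IsSemilinearSet {μ : Fin m → ℕ | combHom u μ ≤ combHom w μ} := by
  have h0 : IsSemilinearSet {t : ℤ | 0 ≤ t} := by
    have : {t : ℤ | 0 ≤ t} = (AddSubmonoid.closure {(1 : ℤ)} : Set ℤ) := by
      ext t
      rw [SetLike.mem_coe, AddSubmonoid.mem_closure_singleton]
      exact ⟨fun ht => ⟨t.toNat, by simpa using ht⟩, by rintro ⟨k, rfl⟩; simp⟩
    rw [this]
    exact IsSemilinearSet.closure_of_finite (Set.finite_singleton _)
  convert h0.preimage (combHom (fun k => w k - u k)) using 1
  ext μ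
  simp [combHom_apply, mul_sub]

theorem isRationalPolyhedron_of_finite {n : ℕ} {T : Set ((Fin n → ℤ) × ℤ)} (hT : T.Finite) :
    IsRationalPolyhedron {x : Fin n → ℝ | ∀ p ∈ T, intVec p.1 ⬝ᵥ x ≤ (p.2 : ℝ)} := by
  obtain ⟨k, f, -, rfl⟩ := hT.fin_param
  refine ⟨k, fun i => (f i).1, fun i => (f i).2, ?_⟩
  ext x
  simp [polyhedron]

/-- For a linear set `a + ⟨t⟩`, slack is additive in the inequality. A generator of negative slack,
repeated often, would violate the family, so validity is equivalent to validity for `a` and for each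
generator. -/
theorem isRationalPolyhedron_of_isSemilinearSet {n : ℕ} {U : Set ((Fin n → ℤ) × ℤ)}
    (hU : IsSemilinearSet U) :
    IsRationalPolyhedron {x : Fin n → ℝ | ∀ p ∈ U, intVec p.1 ⬝ᵥ x ≤ (p.2 : ℝ)} := by
  have hlin : ∀ V : Set ((Fin n → ℤ) × ℤ), IsLinearSet V → ∃ T : Set ((Fin n → ℤ) × ℤ), T.Finite ∧
      ∀ x : Fin n → ℝ, (∀ p ∈ V, intVec p.1 ⬝ᵥ x ≤ (p.2 : ℝ)) ↔
        ∀ p ∈ T, intVec p.1 ⬝ᵥ x ≤ (p.2 : ℝ) := by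
    rintro V ⟨a, t, ht, rfl⟩
    refine ⟨insert a t, ht.insert a, fun x => ?_⟩
    obtain ⟨φ, hφ⟩ : ∃ φ : (Fin n → ℤ) × ℤ →+ ℝ, ∀ p, φ p = p.2 - intVec p.1 ⬝ᵥ x :=
      ⟨⟨⟨fun p => p.2 - intVec p.1 ⬝ᵥ x, by
        have : intVec (0 : Fin n → ℤ) = 0 := by ext; simp [intVec]
        simp [this]⟩, fun p q => by
        have : intVec (p + q).1 = intVec p.1 + intVec q.1 := by ext; simp [intVec]
        simp only [this, add_dotProduct, Prod.snd_add, Int.cast_add]; ring⟩, fun _ => rfl⟩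
    simp only [← sub_nonneg (b := intVec _ ⬝ᵥ x), ← hφ]
    constructor
    · intro h
      have ha : 0 ≤ φ a := h a ⟨0, zero_mem _, by simp⟩
      refine Set.forall_mem_insert.2 ⟨ha, fun q hq => ?_⟩
      by_contra! hneg
      obtain ⟨k, hk⟩ := exists_nat_gt (φ a / -φ q)
      rw [div_lt_iff₀ (by linarith)] at hk
      have := h (a + k • q) ⟨k • q, nsmul_mem (AddSubmonoid.subset_closure hq) k, rfl⟩
      rw [map_add, map_nsmul, nsmul_eq_mul] at this
      linarith
    · rintro h _ ⟨q, hq, rfl⟩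
      simp only [vadd_eq_add, map_add]
      refine add_nonneg (h a (Set.mem_insert _ _)) ?_
      induction hq using AddSubmonoid.closure_induction with
      | mem y hy => exact h y (Set.mem_insert_of_mem _ hy)
      | zero => simp
      | add y z _ _ hy hz => rw [map_add]; exact add_nonneg hy hz
  obtain ⟨C, hC, hCl, rfl⟩ := hU
  choose! T hTf hT using hlin
  convert isRationalPolyhedron_of_finite (hC.biUnion fun V hV => hTf V (hCl V hV)) using 1
  ext x
  simp only [Set.mem_ofPred_eq, Set.mem_sUnion, Set.mem_iUnion]
  constructor
  · rintro h p ⟨V, hV, hp⟩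
    exact (hT V (hCl V hV) x).1 (fun q hq => h q ⟨V, hV, hq⟩) p hp
  · rintro h p ⟨V, hV, hp⟩
    exact (hT V (hCl V hV) x).2 (fun q hq => h q ⟨V, hV, hq⟩) p hp

/-! ### From real to natural multipliers -/

/-- Real nonnegative multipliers of an integral vector can be replaced by rational ones with no
larger support. -/
theorem exists_rat_multipliers {m n : ℕ} {A : Matrix (Fin m) (Fin n) ℤ} {l : Fin m → ℝ}
    {α : Fin n → ℤ} (hl : 0 ≤ l) (hα : ∀ j, (α j : ℝ) = ∑ i, l i * (A i j : ℝ)) :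
    ∃ ρ : Fin m → ℚ, 0 ≤ ρ ∧ (∀ k, l k = 0 → ρ k = 0) ∧
      ∀ j, (α j : ℚ) = ∑ i, ρ i * (A i j : ℚ) := by
  classical
  -- A `ℚ`-linear retraction `f : ℝ → ℚ` turns `l` into a rational solution, possibly with negative
  -- entries. If it differs from `l`, the difference is a kernel direction along which the support
  -- can be reduced.
  obtain ⟨f, hf⟩ := LinearMap.exists_leftInverse_of_injective
    (Algebra.linearMap ℚ ℝ) (LinearMap.ker_eq_bot.2 (algebraMap ℚ ℝ).injective)
  have hf1 : ∀ q : ℚ, f (q : ℝ) = q := fun q => LinearMap.congr_fun hf q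
  have hfz : ∀ z : ℤ, f (z : ℝ) = z := fun z => by exact_mod_cast hf1 z
  have hfmul : ∀ (x : ℝ) (z : ℤ), f (x * z) = f x * z := fun x z => by
    rw [mul_comm, ← zsmul_eq_mul, map_zsmul, zsmul_eq_mul, mul_comm]
  induction hs : (Finset.univ.filter fun k => l k ≠ 0).card using Nat.strong_induction_on
    generalizing l with
  | _ s ih =>
    have hfα : ∀ j, (α j : ℚ) = ∑ i, f (l i) * (A i j : ℚ) := fun j => by
      rw [← hfz, hα, map_sum]
      exact Finset.sum_congr rfl fun i _ => hfmul _ _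
    by_cases hrat : ∀ k, ((f (l k) : ℚ) : ℝ) = l k
    · refine ⟨fun k => f (l k), fun k => ?_, fun k hk => by simp [hk], hfα⟩
      have : (0 : ℝ) ≤ (f (l k) : ℚ) := (hl k).trans_eq (hrat k).symm
      exact_mod_cast this
    · push Not at hrat
      obtain ⟨k, hk⟩ := hrat
      obtain ⟨σ, hσk, hσ0, hσA⟩ : ∃ σ : Fin m → ℝ, (∃ k, 0 < σ k) ∧ (∀ k, l k = 0 → σ k = 0) ∧
          ∀ j, ∑ i, σ i * (A i j : ℝ) = 0 := by
        have h0 : ∀ j, ∑ i, (l i - (f (l i) : ℚ)) * (A i j : ℝ) = 0 := fun j => by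
          have := hfα j
          have h1 : (α j : ℝ) = ∑ i, ((f (l i) : ℚ) : ℝ) * (A i j : ℝ) := by exact_mod_cast this
          simp only [sub_mul, Finset.sum_sub_distrib, ← hα, ← h1, sub_self]
        rcases lt_or_gt_of_ne hk with h | h
        · exact ⟨fun i => l i - (f (l i) : ℚ), ⟨k, sub_pos.2 h⟩, fun i hi => by simp [hi], h0⟩
        · refine ⟨fun i => -(l i - (f (l i) : ℚ)), ⟨k, by linarith⟩, fun i hi => by simp [hi],
            fun j => ?_⟩
          simp only [neg_mul, Finset.sum_neg_distrib, h0, neg_zero]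
      -- Ratio test: moving along `-σ` up to the least ratio keeps all entries nonnegative and makes
      -- entry `k₀` vanish.
      obtain ⟨k₀, hk₀, hmin⟩ := Finset.exists_min_image (Finset.univ.filter fun k => 0 < σ k)
        (fun k => l k / σ k) (by obtain ⟨k, hk⟩ := hσk; exact ⟨k, by simpa using hk⟩)
      have hσk₀ : 0 < σ k₀ := by simpa using hk₀
      have ht : 0 ≤ l k₀ / σ k₀ := div_nonneg (hl k₀) hσk₀.le
      have hl' : 0 ≤ fun k => l k - l k₀ / σ k₀ * σ k := by
        intro k
        simp only [Pi.zero_apply, sub_nonneg]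
        rcases le_or_gt (σ k) 0 with h | h
        · exact (mul_nonpos_of_nonneg_of_nonpos ht h).trans (hl k)
        · exact (le_div_iff₀ h).1 (hmin k (by simpa using h))
      have hsupp : ∀ k, l k = 0 → l k - l k₀ / σ k₀ * σ k = 0 := fun k hk => by
        rw [hk, hσ0 k hk, mul_zero, sub_zero]
      have hcard : (Finset.univ.filter fun k => l k - l k₀ / σ k₀ * σ k ≠ 0).card < s := by
        rw [← hs]
        refine Finset.card_lt_card (Finset.ssubset_iff_of_subset ?_ |>.2 ⟨k₀, ?_, ?_⟩)
        · intro k hk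
          simp only [Finset.mem_filter, Finset.mem_univ, true_and] at hk ⊢
          exact fun h => hk (hsupp k h)
        · simp only [Finset.mem_filter, Finset.mem_univ, true_and]
          exact fun h => hσk₀.ne' (hσ0 k₀ h)
        · simp [div_mul_cancel₀ _ hσk₀.ne']
      obtain ⟨ρ, hρ, hρ0, hρA⟩ := ih _ hcard hl' (fun j => by
        simp only [sub_mul, mul_assoc, Finset.sum_sub_distrib, ← Finset.mul_sum, hσA, ← hα]
        simp) rfl
      exact ⟨ρ, hρ, fun k hk => hρ0 k (hsupp k hk), hρA⟩

theorem exists_nat_multipliers {m n : ℕ} {A : Matrix (Fin m) (Fin n) ℤ} {l : Fin m → ℝ}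
    {α : Fin n → ℤ} (hl : 0 ≤ l) (hα : ∀ j, (α j : ℝ) = ∑ i, l i * (A i j : ℝ)) :
    ∃ N : ℕ, 0 < N ∧ ∃ μ : Fin m → ℕ, (∀ k, l k = 0 → μ k = 0) ∧ N • α = ∑ k, μ k • A k := by
  obtain ⟨ρ, hρ, hρ0, hρA⟩ := exists_rat_multipliers hl hα
  have hN : 0 < ∏ k, (ρ k).den := Finset.prod_pos fun k _ => (ρ k).den_pos
  have hμ : ∀ k, ∃ a : ℕ, (a : ℚ) = (∏ k, (ρ k).den : ℕ) * ρ k := fun k => by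
    obtain ⟨d, hd⟩ := Finset.dvd_prod_of_mem (fun k => (ρ k).den) (Finset.mem_univ k)
    refine ⟨(ρ k).num.toNat * d, ?_⟩
    have h1 : (((ρ k).num.toNat : ℕ) : ℚ) = (ρ k).num := by
      exact_mod_cast Int.toNat_of_nonneg (Rat.num_nonneg.2 (hρ k))
    rw [hd]
    push_cast
    rw [h1, mul_right_comm, Rat.den_mul_eq_num]
  choose μ hμ using hμ
  refine ⟨_, hN, μ, fun k hk => ?_, ?_⟩
  · have := hμ k
    rw [hρ0 k hk, mul_zero] at this
    exact_mod_cast this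
  · ext j
    have : ((∏ k, (ρ k).den : ℕ) : ℚ) * α j = ∑ k, (μ k : ℚ) * A k j := by
      rw [hρA, Finset.mul_sum]
      exact Finset.sum_congr rfl fun k _ => by rw [hμ, mul_assoc]
    simp only [Pi.smul_apply, Finset.sum_apply, nsmul_eq_mul]
    exact_mod_cast this

/-! ### Finitely many points realise the floors -/

/-- Write `z = u + ∑ μ_j rʲ`. Where `α rʲ > 0`, the inequalities `αu ≥ 0` and `αz ≤ β ≤ K α rʲ` give
`μ_j ≤ K`. Where `α rʲ = 0`, the integer part of `μ_j` can be removed without changing `αz`. What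
remains lies in a box independent of `α`. -/
theorem exists_finite_representatives {n g h : ℕ} {S : Set (Fin n → ℤ)}
    (hSconv : ∀ z, intVec z ∈ convInt S → z ∈ S) {v : Fin g → Fin n → ℤ} {r : Fin h → Fin n → ℤ}
    (hform : convInt S =
      convInt (Set.range v) + (coneInt (Set.range r) : Set (Fin n → ℝ))) (K : ℝ) :
    ∃ F : Finset (Fin n → ℤ), (F : Set (Fin n → ℤ)) ⊆ S ∧ ∀ (α : Fin n → ℤ) (β : ℝ),
      (∀ x ∈ convInt S, 0 ≤ intVec α ⬝ᵥ x) → (∀ j, 0 ≤ α ⬝ᵥ r j) →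
      (∀ j, 0 < α ⬝ᵥ r j → β ≤ K * ((α ⬝ᵥ r j : ℤ) : ℝ)) →
      ∀ z ∈ S, ((α ⬝ᵥ z : ℤ) : ℝ) ≤ β → ∃ z' ∈ F, α ⬝ᵥ z' = α ⬝ᵥ z := by
  obtain ⟨C, hC⟩ : ∃ C : ℝ, ∀ u ∈ convInt (Set.range v), ∀ i, |u i| ≤ C := by
    have hb : Bornology.IsBounded (convInt (Set.range v)) :=
      isBounded_convexHull.2 ((Set.finite_range v).image intVec).isBounded
    obtain ⟨C, hC⟩ := hb.exists_norm_le
    exact ⟨C, fun u hu i => (norm_le_pi_norm u i).trans (hC u hu)⟩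
  obtain ⟨R, hR⟩ : ∃ R : ℝ, ∀ i, C + ∑ j, max K 1 * |(r j i : ℝ)| ≤ R := by
    obtain ⟨R, hR⟩ := (Set.finite_range fun i => C + ∑ j, max K 1 * |(r j i : ℝ)|).bddAbove
    exact ⟨R, fun i => hR ⟨i, rfl⟩⟩
  have hfin : {z : Fin n → ℤ | z ∈ S ∧ ∀ i, |z i| ≤ ⌊R⌋}.Finite := by
    refine (Set.finite_Icc (fun _ => -⌊R⌋) (fun _ => ⌊R⌋)).subset fun z hz => ?_
    exact ⟨fun i => (abs_le.1 (hz.2 i)).1, fun i => (abs_le.1 (hz.2 i)).2⟩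
  refine ⟨hfin.toFinset, fun z hz => (hfin.mem_toFinset.1 hz).1, ?_⟩
  intro α β hα hαr hK z hz hzβ
  have hz' := subset_convInt hz
  rw [hform] at hz'
  obtain ⟨u, hu, w, hw, huw⟩ := hz'
  obtain ⟨μ, hμ, rfl⟩ := mem_coneInt_range_iff.1 hw
  have hu0 : 0 ≤ intVec α ⬝ᵥ u := hα u (by
    rw [hform]; exact ⟨u, hu, 0, zero_mem (coneInt (Set.range r)), add_zero u⟩)
  have hz_eq : ((α ⬝ᵥ z : ℤ) : ℝ) = intVec α ⬝ᵥ u + ∑ j, μ j * ((α ⬝ᵥ r j : ℤ) : ℝ) := by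
    rw [← intVec_dotProduct_intVec, ← huw]
    simp only [dotProduct_add, dotProduct_sum, dotProduct_smul, intVec_dotProduct_intVec,
      smul_eq_mul]
  obtain ⟨ν, hν⟩ : ∃ ν : Fin h → ℤ, ν = fun j => if α ⬝ᵥ r j = 0 then ⌊μ j⌋ else 0 := ⟨_, rfl⟩
  have hνα : ∀ j, ν j * (α ⬝ᵥ r j) = 0 := fun j => by
    by_cases h0 : α ⬝ᵥ r j = 0 <;> simp [hν, h0]
  have hμν : ∀ j, 0 ≤ μ j - ν j ∧ μ j - ν j ≤ max K 1 := by
    intro j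
    by_cases h0 : α ⬝ᵥ r j = 0
    · simp only [hν, h0, if_true]
      exact ⟨Int.fract_nonneg _, (Int.fract_lt_one _).le.trans (le_max_right _ _)⟩
    · simp only [hν, h0, if_false, Int.cast_zero, sub_zero]
      refine ⟨hμ j, le_trans ?_ (le_max_left _ _)⟩
      have hpos : 0 < α ⬝ᵥ r j := lt_of_le_of_ne (hαr j) (Ne.symm h0)
      have hposR : (0 : ℝ) < ((α ⬝ᵥ r j : ℤ) : ℝ) := by exact_mod_cast hpos
      have h1 := Finset.single_le_sum (f := fun j => μ j * ((α ⬝ᵥ r j : ℤ) : ℝ))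
        (fun j _ => mul_nonneg (hμ j) (by exact_mod_cast hαr j)) (Finset.mem_univ j)
      have h2 := hK j hpos
      exact le_of_mul_le_mul_right (by linarith) hposR
  have hz'eq : intVec (z - ∑ j, ν j • r j) = u + ∑ j, (μ j - ν j) • intVec (r j) := by
    ext i
    have := congrFun huw i
    simp only [intVec, Pi.add_apply, Finset.sum_apply, Pi.smul_apply, smul_eq_mul, Pi.sub_apply,
      sub_mul, Finset.sum_sub_distrib] at this ⊢
    push_cast
    rw [← this]
    ring
  refine ⟨z - ∑ j, ν j • r j, hfin.mem_toFinset.2 ⟨hSconv _ ?_, fun i => ?_⟩, ?_⟩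
  · rw [hz'eq, hform]
    exact ⟨u, hu, _, mem_coneInt_range_iff.2 ⟨_, fun j => (hμν j).1, rfl⟩, rfl⟩
  · rw [Int.le_floor, Int.cast_abs]
    refine le_trans ?_ (hR i)
    have := congrFun hz'eq i
    simp only [intVec, Pi.add_apply, Finset.sum_apply, Pi.smul_apply, smul_eq_mul] at this
    rw [this]
    refine (abs_add_le _ _).trans (add_le_add (hC u hu i) ?_)
    refine (Finset.abs_sum_le_sum_abs _ _).trans (Finset.sum_le_sum fun j _ => ?_)
    rw [abs_mul, abs_of_nonneg (hμν j).1]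
    exact mul_le_mul_of_nonneg_right (hμν j).2 (abs_nonneg _)
  · simp only [dotProduct_sub, dotProduct_sum, dotProduct_smul, smul_eq_mul, hνα,
      Finset.sum_const_zero, sub_zero]

/-! ### Polyhedrality of the bounded closure -/

theorem combHom_dotProduct {m n : ℕ} (A : Matrix (Fin m) (Fin n) ℤ) (μ : Fin m → ℕ)
    (z : Fin n → ℤ) : combHom (fun k => A k) μ ⬝ᵥ z = combHom (fun k => A k ⬝ᵥ z) μ := by
  simp only [combHom_apply, sum_dotProduct, smul_dotProduct]

theorem cast_combHom {m : ℕ} (w : Fin m → ℤ) (μ : Fin m → ℕ) :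
    ((combHom w μ : ℤ) : ℝ) = ∑ k, (μ k : ℝ) * (w k : ℝ) := by
  simp [combHom_apply]

theorem cast_combHom_rows {m n : ℕ} (A : Matrix (Fin m) (Fin n) ℤ) (μ : Fin m → ℕ) (j : Fin n) :
    ((combHom (fun k => A k) μ j : ℤ) : ℝ) = ∑ k, (μ k : ℝ) * (A k j : ℝ) := by
  simp [combHom_apply]

/-- Natural multipliers whose pairs are supporting, with intercepts bounded by `K`. -/
def boundedMultipliers {m n h : ℕ} (A : Matrix (Fin m) (Fin n) ℤ) (b : Fin m → ℤ)
    (r : Fin h → Fin n → ℤ) (K : ℤ) : Set (Fin m → ℕ) :=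
  {μ | IsTight A b (fun k => μ k) ∧ ∀ j, 0 < combHom (fun k => A k ⬝ᵥ r j) μ →
    combHom b μ ≤ combHom (fun k => K * (A k ⬝ᵥ r j)) μ}

theorem isSemilinearSet_boundedMultipliers {m n h : ℕ} (A : Matrix (Fin m) (Fin n) ℤ)
    (b : Fin m → ℤ) (r : Fin h → Fin n → ℤ) (K : ℤ) :
    IsSemilinearSet (boundedMultipliers A b r K) := by
  rw [boundedMultipliers, Set.ofPred_and]
  refine IsSemilinearSet.inter ?_ ?_
  -- Tightness depends only on the support, which must lie in one of finitely many jointly tight row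
  -- sets `I`.
  · have : {μ : Fin m → ℕ | IsTight A b (fun k => μ k)} =
        ⋃ I ∈ {I : Finset (Fin m) | ∃ x ∈ polyhedron A b, ∀ k ∈ I, intVec (A k) ⬝ᵥ x = b k},
          ⋂ k ∈ Iᶜ, {μ : Fin m → ℕ | combHom (Pi.single k (1 : ℤ)) μ ≤ combHom 0 μ} := by
      ext μ
      have hc : ∀ k, combHom (Pi.single k (1 : ℤ)) μ ≤ combHom 0 μ ↔ μ k = 0 := fun k => by
        simp [combHom_apply, Pi.single_apply]
      simp only [Set.mem_ofPred_eq, Set.mem_iUnion, Set.mem_iInter, hc, exists_prop]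
      constructor
      · rintro ⟨-, x, hx, ht⟩
        refine ⟨Finset.univ.filter fun k => μ k ≠ 0, ⟨x, hx, fun k hk => ht k ?_⟩, fun k hk => ?_⟩
        · simp only [Finset.mem_filter, Finset.mem_univ, true_and] at hk
          exact Nat.cast_pos.2 (Nat.pos_of_ne_zero hk)
        · simpa using hk
      · rintro ⟨I, ⟨x, hx, ht⟩, h0⟩
        refine ⟨fun k => Nat.cast_nonneg _, x, hx, fun k hk => ht k ?_⟩
        by_contra hkI
        simp [h0 k (Finset.mem_compl.2 hkI)] at hk
    rw [this]
    exact IsSemilinearSet.biUnion (Set.toFinite _) fun I _ =>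
      IsSemilinearSet.biInter_finset fun k _ => isSemilinearSet_combHom_le _ _
  · rw [Set.ofPred_forall]
    refine IsSemilinearSet.iInter fun j => ?_
    convert (isSemilinearSet_combHom_le (fun k => A k ⬝ᵥ r j) 0).union
      (isSemilinearSet_combHom_le b (fun k => K * (A k ⬝ᵥ r j))) using 1
    ext μ
    have h0 : combHom (0 : Fin m → ℤ) μ = 0 := by simp [combHom_apply]
    simp only [Set.mem_ofPred_eq, Set.mem_union, h0]
    rw [imp_iff_not_or, not_lt]

theorem isRationalPolyhedron_sCGClosureOf_boundedPairs {m n h : ℕ} {S : Set (Fin n → ℤ)}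
    {A : Matrix (Fin m) (Fin n) ℤ} {b : Fin m → ℤ} {r : Fin h → Fin n → ℤ} {K : ℤ}
    (hSA : ∀ x ∈ convInt S, ∀ k, 0 ≤ intVec (A k) ⬝ᵥ x) (hAr : ∀ j, 0 ≤ A *ᵥ r j)
    {F : Finset (Fin n → ℤ)} (hFS : (F : Set (Fin n → ℤ)) ⊆ S)
    (hF : ∀ (α : Fin n → ℤ) (β : ℝ),
      (∀ x ∈ convInt S, 0 ≤ intVec α ⬝ᵥ x) → (∀ j, 0 ≤ α ⬝ᵥ r j) →
      (∀ j, 0 < α ⬝ᵥ r j → β ≤ K * ((α ⬝ᵥ r j : ℤ) : ℝ)) →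
      ∀ z ∈ S, ((α ⬝ᵥ z : ℤ) : ℝ) ≤ β → ∃ z' ∈ F, α ⬝ᵥ z' = α ⬝ᵥ z) :
    IsRationalPolyhedron (sCGClosureOf S (boundedPairs A b r K)) := by
  have hmem : ∀ x, x ∈ sCGClosureOf S (boundedPairs A b r K) ↔ ∀ μ ∈ boundedMultipliers A b r K,
      ∃ z ∈ F, combHom (fun k => A k ⬝ᵥ z) μ ≤ combHom b μ ∧
        intVec (combHom (fun k => A k) μ) ⬝ᵥ x ≤ ((combHom (fun k => A k ⬝ᵥ z) μ : ℤ) : ℝ) := by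
    intro x
    rw [mem_sCGClosureOf_iff]
    constructor
    · rintro h μ ⟨ht, hK⟩
      have hKR : ∀ j, 0 < combHom (fun k => A k) μ ⬝ᵥ r j →
          ((combHom b μ : ℤ) : ℝ) ≤ K * ((combHom (fun k => A k) μ ⬝ᵥ r j : ℤ) : ℝ) := by
        intro j hj
        rw [combHom_dotProduct] at hj ⊢
        have h1 := hK j hj
        have h2 : combHom (fun k => K * (A k ⬝ᵥ r j)) μ = K * combHom (fun k => A k ⬝ᵥ r j) μ := by
          simp only [combHom_apply, Finset.mul_sum, mul_smul_comm]
        rw [h2] at h1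
        exact_mod_cast h1
      have hmem : (combHom (fun k => A k) μ, ((combHom b μ : ℤ) : ℝ)) ∈ boundedPairs A b r K := by
        refine ⟨mem_supportingPairs_iff.2 ⟨_, ht, cast_combHom_rows A μ, cast_combHom b μ⟩,
          fun j hj => ?_⟩
        exact (div_le_iff₀ (by exact_mod_cast hj)).2 (hKR j hj)
      obtain ⟨z, hz, hzβ, hxz⟩ := mem_sCGCut_iff.1 (h _ hmem)
      simp only [intVec_dotProduct_intVec] at hzβ hxz
      obtain ⟨z', hz', he⟩ := hF _ _ (fun y hy => by
          rw [intVec_dotProduct_of_eq_sum (cast_combHom_rows A μ)]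
          exact Finset.sum_nonneg fun k _ => mul_nonneg (Nat.cast_nonneg _) (hSA y hy k))
        (fun j => by
          rw [combHom_dotProduct, combHom_apply]
          exact Finset.sum_nonneg fun k _ =>
            nsmul_nonneg (show 0 ≤ A k ⬝ᵥ r j from hAr j k) _) hKR z hz hzβ
      rw [← he, combHom_dotProduct] at hzβ hxz
      exact ⟨z', hz', by exact_mod_cast hzβ, hxz⟩
    · rintro h ⟨α, β⟩ ⟨hp, hK⟩
      obtain ⟨l, ⟨hl, y, hy, ht⟩, hα, hβ⟩ := mem_supportingPairs_iff.1 hp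
      simp only at hα hβ hK ⊢
      obtain ⟨N, hN, μ, hμ0, hμ⟩ := exists_nat_multipliers hl hα
      have hNR : (0 : ℝ) < N := by exact_mod_cast hN
      have hμ' : combHom (fun k => A k) μ = N • α := hμ.symm
      have hμt : ∀ k, 0 < (μ k : ℝ) → intVec (A k) ⬝ᵥ y = b k := fun k hk =>
        ht k (lt_of_le_of_ne (hl k) fun h0 => by rw [hμ0 k h0.symm] at hk; simp at hk)
      have hNα : ∀ v, intVec (combHom (fun k => A k) μ) ⬝ᵥ v = N * (intVec α ⬝ᵥ v) := fun v => by
        have : intVec (N • α) = (N : ℝ) • intVec α := by ext; simp [intVec]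
        rw [hμ', this, smul_dotProduct, smul_eq_mul]
      have hval : ∀ (t : Fin m → ℝ), (∀ k, 0 ≤ t k) →
          (∀ k, 0 < t k → intVec (A k) ⬝ᵥ y = b k) →
          ∑ k, t k * (intVec (A k) ⬝ᵥ y) = ∑ k, t k * (b k : ℝ) := fun t ht0 ht =>
        Finset.sum_congr rfl fun k _ => by
          rcases (ht0 k).eq_or_lt with h0 | h0
          · rw [← h0, zero_mul, zero_mul]
          · rw [ht k h0]
      -- `μ` need not be proportional to `l`, but both are supported on rows tight at `y`, so each
      -- right-hand side is the value at `y`.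
      have hNβ : ((combHom b μ : ℤ) : ℝ) = N * β := by
        rw [cast_combHom, ← hval _ (fun k => Nat.cast_nonneg _) hμt, hβ, ← hval l hl ht,
          ← intVec_dotProduct_of_eq_sum hα, ← hNα,
          intVec_dotProduct_of_eq_sum (cast_combHom_rows A μ)]
      have hz := h μ ⟨⟨fun k => Nat.cast_nonneg _, y, hy, hμt⟩, fun j hj => by
        rw [← combHom_dotProduct, hμ', smul_dotProduct] at hj
        have hj' : 0 < α ⬝ᵥ r j := pos_of_smul_pos_left hj (by positivity)
        have h1 := (div_le_iff₀ (by exact_mod_cast hj')).1 (hK j hj')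
        have h2 : combHom (fun k => K * (A k ⬝ᵥ r j)) μ = K * (N * (α ⬝ᵥ r j)) := by
          have : combHom (fun k => A k ⬝ᵥ r j) μ = N * (α ⬝ᵥ r j) := by
            rw [← combHom_dotProduct, hμ', smul_dotProduct, nsmul_eq_mul]
          rw [← this]
          simp only [combHom_apply, Finset.mul_sum, mul_smul_comm]
        have h3 : ((combHom b μ : ℤ) : ℝ) ≤ ((K * (N * (α ⬝ᵥ r j)) : ℤ) : ℝ) := by
          rw [hNβ]
          push_cast
          nlinarith
        rw [h2]
        exact_mod_cast h3⟩
      obtain ⟨z, hz, hzβ, hxz⟩ := hz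
      rw [← combHom_dotProduct] at hzβ hxz
      rw [← intVec_dotProduct_intVec, hNα, hNα] at hxz
      have hzβ' : ((combHom (fun k => A k) μ ⬝ᵥ z : ℤ) : ℝ) ≤ ((combHom b μ : ℤ) : ℝ) := by
        exact_mod_cast hzβ
      rw [← intVec_dotProduct_intVec, hNα, hNβ] at hzβ'
      exact mem_sCGCut_iff.2 ⟨z, hFS hz, le_of_mul_le_mul_left hzβ' hNR,
        le_of_mul_le_mul_left hxz hNR⟩
  -- If no point of `F` is admissible for some `μ`, the closure is empty and is written as `0 x ≤
  -- -1`.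
  by_cases hempty : ∃ μ ∈ boundedMultipliers A b r K,
      ∀ z ∈ F, combHom b μ < combHom (fun k => A k ⬝ᵥ z) μ
  · obtain ⟨μ, hμ, hμF⟩ := hempty
    refine ⟨1, 0, fun _ => -1, ?_⟩
    ext x
    rw [hmem]
    refine iff_of_false (fun h => ?_) (fun h => ?_)
    · obtain ⟨z, hz, hzβ, -⟩ := h μ hμ
      exact (hμF z hz).not_ge hzβ
    · have := h 0
      simp [intVec, dotProduct] at this
      linarith
  push Not at hempty
  -- `V z` collects the multipliers whose floor over `F` is attained at `z`. On it the right-hand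
  -- side of the cut is linear in `μ`, so its image is semilinear.
  obtain ⟨V, hV⟩ : ∃ V : (Fin n → ℤ) → Set (Fin m → ℕ), V = fun z =>
      boundedMultipliers A b r K ∩ ({μ | combHom (fun k => A k ⬝ᵥ z) μ ≤ combHom b μ} ∩
        ⋂ y ∈ F, ({μ | combHom (fun k => A k ⬝ᵥ y) μ ≤ combHom b μ}ᶜ ∪
          {μ | combHom (fun k => A k ⬝ᵥ y) μ ≤ combHom (fun k => A k ⬝ᵥ z) μ})) := ⟨_, rfl⟩
  have hVs : ∀ z, IsSemilinearSet (V z) := fun z => by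
    rw [hV]
    exact (isSemilinearSet_boundedMultipliers A b r K).inter
      ((isSemilinearSet_combHom_le _ _).inter (IsSemilinearSet.biInter_finset fun y _ =>
        (isSemilinearSet_combHom_le _ _).compl.union (isSemilinearSet_combHom_le _ _)))
  have hUs : IsSemilinearSet (⋃ z ∈ F, combHom (fun k => (A k, A k ⬝ᵥ z)) '' V z) :=
    IsSemilinearSet.biUnion_finset fun z _ => (hVs z).image _
  convert isRationalPolyhedron_of_isSemilinearSet hUs using 1
  ext x
  have hfst : ∀ z μ, (combHom (fun k => (A k, A k ⬝ᵥ z)) μ).1 = combHom (fun k => A k) μ :=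
    fun z μ => by simp only [combHom_apply, Prod.fst_sum, Prod.smul_fst]
  have hsnd : ∀ z μ, (combHom (fun k => (A k, A k ⬝ᵥ z)) μ).2 = combHom (fun k => A k ⬝ᵥ z) μ :=
    fun z μ => by simp only [combHom_apply, Prod.snd_sum, Prod.smul_snd]
  rw [hmem]
  simp only [Set.mem_ofPred_eq, Set.mem_iUnion, Set.mem_image]
  constructor
  · rintro h _ ⟨z, hz, μ, hμ, rfl⟩
    rw [hfst, hsnd]
    rw [hV] at hμ
    obtain ⟨hμΛ, -, hμmax⟩ := hμ
    obtain ⟨y, hy, hyβ, hxy⟩ := h μ hμΛ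
    refine hxy.trans ?_
    have := (Set.mem_iInter₂.1 hμmax y hy).resolve_left (fun hn => hn hyβ)
    exact_mod_cast this
  · intro h μ hμ
    obtain ⟨z₀, hz₀, hz₀β⟩ := hempty μ hμ
    obtain ⟨z, hz, hmax⟩ := Finset.exists_max_image
      (F.filter fun z => combHom (fun k => A k ⬝ᵥ z) μ ≤ combHom b μ)
      (fun z => combHom (fun k => A k ⬝ᵥ z) μ) ⟨z₀, Finset.mem_filter.2 ⟨hz₀, hz₀β⟩⟩
    rw [Finset.mem_filter] at hz
    have hμV : μ ∈ V z := by
      rw [hV]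
      refine ⟨hμ, hz.2, Set.mem_iInter₂.2 fun y hy => ?_⟩
      by_cases hyβ : combHom (fun k => A k ⬝ᵥ y) μ ≤ combHom b μ
      · exact Or.inr (hmax y (Finset.mem_filter.2 ⟨hy, hyβ⟩))
      · exact Or.inl hyβ
    have := h _ ⟨z, hz.1, μ, hμV, rfl⟩
    rw [hfst, hsnd] at this
    exact ⟨z, hz.1, hz.2, this⟩

theorem mainTheorem5 {n₁ n₂ g h m : ℕ}
    (S : Set (Fin (n₁ + n₂) → ℤ)) (hS : S.Nonempty)
    (hSconv : ∀ z, intVec z ∈ convInt S → z ∈ S)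
    (v : Fin g → Fin (n₁ + n₂) → ℤ) (r : Fin h → Fin (n₁ + n₂) → ℤ)
    (hform : convInt S =
      convInt (Set.range v) + (coneInt (Set.range r) : Set (Fin (n₁ + n₂) → ℝ)))
    (hpointed : (coneInt (Set.range r) : ConvexCone ℝ (Fin (n₁ + n₂) → ℝ)).Salient)
    (hdim : Module.finrank ℝ
      (Submodule.span ℝ (coneInt (Set.range r) : Set (Fin (n₁ + n₂) → ℝ))) = n₂)
    (hperp : ∀ x ∈ coneInt (Set.range r), ∀ k : Fin n₁, x (Fin.castAdd n₂ k) = 0)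
    (hsub : convInt S ⊆
      (coneInt (Set.range (unitVec n₁ n₂) ∪ Set.range r) : Set (Fin (n₁ + n₂) → ℝ)))
    (A : Matrix (Fin m) (Fin (n₁ + n₂)) ℤ) (b : Fin m → ℤ)
    (hAe : ∀ k, 0 ≤ A *ᵥ unitVec n₁ n₂ k) (hAr : ∀ j, 0 ≤ A *ᵥ r j) (hb : 0 ≤ b) :
    sCGClosure S A b = sCGClosureOf S (boundedPairs A b r (interceptBound A b r)) ∧
      IsRationalPolyhedron (sCGClosure S A b) := by
  have hSrow : ∀ x ∈ convInt S, ∀ k, 0 ≤ intVec (A k) ⬝ᵥ x := fun x hx k =>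
    dotProduct_nonneg_of_mem_coneInt (T := Set.range (unitVec n₁ n₂) ∪ Set.range r) (by
      rintro _ (⟨t, rfl⟩ | ⟨j, rfl⟩) <;> rw [intVec_dotProduct_intVec]
      · exact_mod_cast hAe t k
      · exact_mod_cast hAr j k) (hsub hx)
  have hSA : ∀ z ∈ S, ∀ k, 0 ≤ A k ⬝ᵥ z := fun z hz k => by
    have := hSrow _ (subset_convInt hz) k
    rw [intVec_dotProduct_intVec] at this
    exact_mod_cast this
  have hSr : ∀ z ∈ S, ∀ j, ∀ N : ℕ, z + N • r j ∈ S := fun z hz j N => by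
    have hz' := subset_convInt hz
    rw [hform] at hz'
    obtain ⟨u, hu, w, hw, huw⟩ := hz'
    have hNr : intVec (N • r j) ∈ coneInt (Set.range r) := by
      have : intVec (N • r j) = N • intVec (r j) := by ext; simp [intVec]
      rw [this]
      have hr : intVec (r j) ∈ coneInt (Set.range r) :=
        PointedCone.subset_hull (Set.mem_image_of_mem intVec (Set.mem_range_self j))
      exact nsmul_mem hr N
    refine hSconv _ ?_
    rw [hform]
    refine ⟨u, hu, w + intVec (N • r j), add_mem hw hNr, ?_⟩
    have huw' : u + w = intVec z := huw
    change u + (w + intVec (N • r j)) = _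
    rw [← add_assoc, huw']
    ext; simp [intVec]
  have heq : sCGClosure S A b = sCGClosureOf S (boundedPairs A b r (interceptBound A b r)) := by
    ext x
    refine ⟨fun hx => mem_sCGClosureOf_iff.2 fun p hp => mem_sCGClosureOf_iff.1 hx p hp.1,
      fun hx => mem_sCGClosureOf_iff.2 fun p hp =>
        mem_sCGCut_of_mem_closure hSr hSA hAe hAr hb hx hp⟩
  refine ⟨heq, heq ▸ ?_⟩
  obtain ⟨F, hFS, hF⟩ := exists_finite_representatives hSconv hform (interceptBound A b r : ℝ)
  exact isRationalPolyhedron_sCGClosureOf_boundedPairs hSrow hAr hFS hF
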